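/- Consider the two-stage robust optimization problem with decision-dependent uncertainty $$w^*=\min_{x\in\mathcal X}\; c_1x+\max_{u\in\mathcal U(x)}\;\min_{y\in\mathcal Y(x,u)} c_2y,$$ where $\mathcal X=\{x\in\mathbb Z_+^{m_x}\times\mathbb R_+^{n_x}:Ax\ge b\}$, $\mathcal U(x)=\{u\in\mathbb R_+^{n_u}:F(x)u\le h+Gx\}$ and $\mathcal Y(x,u)=\{y\in\mathbb R_+^{n_y}:B_2y\ge d-B_1x-Eu\}$; $B_2$ has $\mu_y$ rows and $F(x)$ is any matrix-valued function of $x$. Assume that (A1) $\mathcal U(x)\neq\emptyset$ and (A2) $\mathcal U(x)$ is bounded for every $x\in\mathcal X$, and (A3) $\min\{c_1x+c_2y: x\in\mathcal X,\,u\in\mathcal U(x),\,y\in\mathcal Y(x,u)\}$ has a finite optimal value (it is feasible and bounded below). A decision $x\in\mathcal X$ is feasible if $\mathcal Y(x,u)\ne\emptyset$ for all $u\in\mathcal U(x)$; the problem is infeasible if no $x$ is feasible. Let $\Pi=\{\pi\ge 0:B_2^{\top}\pi\le c_2^{\top}\}$, let $\mathcal P_\Pi$ be the set of its extreme points and $\mathcal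 R_\Pi$ the set of its extreme rays (half-lines that are extreme in its recession cone). For a vector $\beta$ let $\mathcal O(x,\beta)$ be the set of pairs $(u,\lambda)$ that satisfy the KKT conditions of $\max\{(-Eu)^{\top}\beta:u\in\mathcal U(x)\}$. Benders C&CG with tolerance $TOL$: 1. Set $LB=-\infty$, $UB=+\infty$, $\hat{\mathcal P}=\hat{\mathcal R}=\emptyset$. 2. Solve the master problem: minimize $c_1x+\eta$ subject to $x\in\mathcal X$; $\eta\ge\pi^{\top}(d-B_1x-Eu^{\pi})$ and $(u^\pi,\lambda^\pi)\in\mathcal O(x,\pi)$ for all $\pi\in\hat{\mathcal P}$; $\gamma^{\top}(d-B_1x-Ev^{\gamma})\le 0$ and $(v^\gamma,\zeta^\gamma)\in\mathcal O(x,\gamma)$ for all $\gamma\in\hat{\mathcal R}$. If it is infeasible, report infeasibility and terminate. Otherwise take an optimal solution with first-stage part $x^*$ and let $LB$ be its value. While $\hat{\mathcal P}=\emptyset$ the variable $\eta$ is not bounded below; then $LB=-\infty$ and $x^*$ is the first-stage part of any feasible point. 3. Compute an optimal $u_f^*$ and the value $\eta_f(x^*)$ of $\max_{u\in\mathcal U(x^*)}\min\{\mathbf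 1^{\top}\tilde y:B_2y+\tilde y\ge d-B_1x^*-Eu,\;y,\tilde y\ge0\}$. 4. If $\eta_f(x^*)=0$, compute $\eta_s(x^*)=\max_{u\in\mathcal U(x^*)}\min\{c_2y:y\in\mathcal Y(x^*,u)\}$, an optimal $u_s^*$ and an extreme point $\pi^*$ of $\Pi$ with $(d-B_1x^*-Eu_s^*)^{\top}\pi^*=\eta_s(x^*)$, and add $\pi^*$ to $\hat{\mathcal P}$. If $\eta_f(x^*)>0$, set $\eta_s(x^*)=+\infty$, compute a generator $\gamma^*$ of an extreme ray of $\Pi$ with $(d-B_1x^*-Eu_f^*)^{\top}\gamma^*>0$, and add $\gamma^*$ to $\hat{\mathcal R}$. 5. Set $UB=\min\{UB,\,c_1x^*+\eta_s(x^*)\}$; the incumbent becomes $x^*$ if $c_1x^*+\eta_s(x^*)$ attains the new $UB$, and is kept otherwise. 6. If $UB-LB\le TOL$, return the incumbent and terminate. Otherwise go to step 2. **Theorem.** Let $TOL=0$. Then, for every run of the algorithm (for all choices among the admissible answers to the subproblems): (i) $\mathcal P_\Pi$ and $\mathcal R_\Pi$ are finite, and the number of iterations performed before the terminating one is at most $|\mathcal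 P_\Pi|+|\mathcal R_\Pi|$. This number depends on $B_2$ and $c_2$ only, and in particular not on $\mathcal U(x)$. Moreover $|\mathcal P_\Pi|\le\binom{n_y+\mu_y}{\mu_y}$ and $|\mathcal P_\Pi|+|\mathcal R_\Pi|\le\binom{n_y+\mu_y+1}{\mu_y}$; if $\mu_y\le n_y+1$, then $|\mathcal P_\Pi|+|\mathcal R_\Pi|\le 2\binom{n_y+\mu_y}{\mu_y}$. (ii) If the algorithm reports infeasibility, the two-stage problem is infeasible. If it returns $x$, then $w^*$ is finite, $LB=UB=w^*$, and $x$ is a feasible first-stage decision with $c_1x+\max_{u\in\mathcal U(x)}\min_{y\in\mathcal Y(x,u)}c_2y=w^*$. (iii) An iteration can always be carried out provided its master problem can be solved exactly, that is, has an optimal solution whenever it is feasible and $\hat{\mathcal P}\neq\emptyset$. Hence, if all master problems that can be met have this property, every partial run can be continued until the algorithm terminates, with a correct report of infeasibility or with an optimal solution, and the bound in (i) holds for the continued run. -/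

import Mathlib

open scoped Matrix

namespace TwoStageDDU

/-- The data of a two-stage robust optimization problem with decision-dependent uncertainty:
`min_{x ∈ 𝒳} c₁ x + max_{u ∈ 𝒰(x)} min_{y ∈ 𝒴(x,u)} c₂ y`, with a mixed-integer first stage
(`mx` integer and `nx` continuous variables) and with continuous uncertainty and recourse
variables.  The matrix `F x` may depend on `x` in an arbitrary way. -/
structure Data (mx nx nu ny rx ru ry : ℕ) where
  c₁ : Fin mx ⊕ Fin nx → ℝ
  c₂ : Fin ny → ℝ
  A : Matrix (Fin rx) (Fin mx ⊕ Fin nx) ℝ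
  b : Fin rx → ℝ
  F : (Fin mx ⊕ Fin nx → ℝ) → Matrix (Fin ru) (Fin nu) ℝ
  h : Fin ru → ℝ
  G : Matrix (Fin ru) (Fin mx ⊕ Fin nx) ℝ
  B₁ : Matrix (Fin ry) (Fin mx ⊕ Fin nx) ℝ
  B₂ : Matrix (Fin ry) (Fin ny) ℝ
  d : Fin ry → ℝ
  E : Matrix (Fin ry) (Fin nu) ℝ

/-! ### The recourse dual polyhedron, its extreme points and its extreme rays -/

/-- `Π = {π ≥ 0 : B₂ᵀ π ≤ c₂ᵀ}`; it depends on `B₂` and `c₂` only. -/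
def dualPolyhedron {ny ry : ℕ} (B₂ : Matrix (Fin ry) (Fin ny) ℝ) (c₂ : Fin ny → ℝ) :
    Set (Fin ry → ℝ) :=
  {π | B₂ᵀ *ᵥ π ≤ c₂ ∧ 0 ≤ π}

/-- The directions of recession of a set. -/
def recessionCone {r : ℕ} (S : Set (Fin r → ℝ)) : Set (Fin r → ℝ) :=
  {γ | ∀ π ∈ S, ∀ t : ℝ, 0 ≤ t → π + t • γ ∈ S}

/-- The half-line from the origin spanned by `γ`. -/
def halfLine {r : ℕ} (γ : Fin r → ℝ) : Set (Fin r → ℝ) :=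
  {δ | ∃ t : ℝ, 0 ≤ t ∧ δ = t • γ}

/-- The nonzero vectors that span an extreme ray of `S`, that is, a half-line that is an extreme
subset of the recession cone of `S`. -/
def extremeDirections {r : ℕ} (S : Set (Fin r → ℝ)) : Set (Fin r → ℝ) :=
  {γ | γ ≠ 0 ∧ IsExtreme ℝ (recessionCone S) (halfLine γ)}

/-- The set of extreme rays of `S`; positive multiples of a direction give the same ray. -/
def extremeRays {r : ℕ} (S : Set (Fin r → ℝ)) : Set (Set (Fin r → ℝ)) :=
  halfLine '' extremeDirections S

/-- `𝒫_Π`, the set of extreme points of `Π`. -/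
def dualPoints {ny ry : ℕ} (B₂ : Matrix (Fin ry) (Fin ny) ℝ) (c₂ : Fin ny → ℝ) :
    Set (Fin ry → ℝ) :=
  Set.extremePoints ℝ (dualPolyhedron B₂ c₂)

/-- `ℛ_Π`, the set of extreme rays of `Π`. -/
def dualRays {ny ry : ℕ} (B₂ : Matrix (Fin ry) (Fin ny) ℝ) (c₂ : Fin ny → ℝ) :
    Set (Set (Fin ry → ℝ)) :=
  extremeRays (dualPolyhedron B₂ c₂)

namespace Data

variable {mx nx nu ny rx ru ry : ℕ} (I : Data mx nx nu ny rx ru ry)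

/-! ### The optimization problem -/

/-- `𝒳 = {x ∈ ℤ₊^mx × ℝ₊^nx : A x ≥ b}`. -/
def X : Set (Fin mx ⊕ Fin nx → ℝ) :=
  {x | 0 ≤ x ∧ (∀ i : Fin mx, ∃ k : ℕ, x (Sum.inl i) = (k : ℝ)) ∧ I.b ≤ I.A *ᵥ x}

/-- `𝒰(x) = {u ≥ 0 : F(x) u ≤ h + G x}`. -/
def U (x : Fin mx ⊕ Fin nx → ℝ) : Set (Fin nu → ℝ) :=
  {u | 0 ≤ u ∧ I.F x *ᵥ u ≤ I.h + I.G *ᵥ x}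

/-- The right-hand side `d - B₁ x - E u` of the recourse problem. -/
def rhs (x : Fin mx ⊕ Fin nx → ℝ) (u : Fin nu → ℝ) : Fin ry → ℝ :=
  I.d - I.B₁ *ᵥ x - I.E *ᵥ u

/-- `𝒴(x,u) = {y ≥ 0 : B₂ y ≥ d - B₁ x - E u}`. -/
def Y (x : Fin mx ⊕ Fin nx → ℝ) (u : Fin nu → ℝ) : Set (Fin ny → ℝ) :=
  {y | 0 ≤ y ∧ I.rhs x u ≤ I.B₂ *ᵥ y}

/-- The optimal value of the recourse problem (`+∞` if it is infeasible). -/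
noncomputable def recourseValue (x : Fin mx ⊕ Fin nx → ℝ) (u : Fin nu → ℝ) : EReal :=
  ⨅ y ∈ I.Y x u, ((I.c₂ ⬝ᵥ y : ℝ) : EReal)

/-- The worst-case recourse cost of `x`. -/
noncomputable def worstCase (x : Fin mx ⊕ Fin nx → ℝ) : EReal :=
  ⨆ u ∈ I.U x, I.recourseValue x u

/-- The optimal value `w*` of the two-stage problem. -/
noncomputable def optValue : EReal :=
  ⨅ x ∈ I.X, ((I.c₁ ⬝ᵥ x : ℝ) : EReal) + I.worstCase x

/-- `x ∈ 𝒳` is feasible if the recourse problem is feasible for every scenario in `𝒰(x)`. -/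
def IsFeasible (x : Fin mx ⊕ Fin nx → ℝ) : Prop :=
  x ∈ I.X ∧ ∀ u ∈ I.U x, (I.Y x u).Nonempty

/-- `x` is an optimal first-stage solution: it is feasible and its cost is `w*`. -/
def IsOptimal (x : Fin mx ⊕ Fin nx → ℝ) : Prop :=
  I.IsFeasible x ∧ ((I.c₁ ⬝ᵥ x : ℝ) : EReal) + I.worstCase x = I.optValue

/-- The set of objective values of `min {c₁ x + c₂ y : x ∈ 𝒳, u ∈ 𝒰(x), y ∈ 𝒴(x,u)}`. -/
def relaxationCosts : Set ℝ :=
  {v | ∃ x ∈ I.X, ∃ u ∈ I.U x, ∃ y ∈ I.Y x u, v = I.c₁ ⬝ᵥ x + I.c₂ ⬝ᵥ y}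

/-! ### Subproblems and master problem -/

/-- The inner minimum of the first subproblem:
`min {1ᵀ ỹ : B₂ y + ỹ ≥ d - B₁ x - E u, y ≥ 0, ỹ ≥ 0}`. -/
noncomputable def infeasibility (x : Fin mx ⊕ Fin nx → ℝ) (u : Fin nu → ℝ) : EReal :=
  ⨅ p ∈ {p : (Fin ny → ℝ) × (Fin ry → ℝ) |
      0 ≤ p.1 ∧ 0 ≤ p.2 ∧ I.rhs x u ≤ I.B₂ *ᵥ p.1 + p.2}, ((∑ i, p.2 i : ℝ) : EReal)

/-- `η_f(x)`, the optimal value of the first subproblem. -/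
noncomputable def etaF (x : Fin mx ⊕ Fin nx → ℝ) : EReal :=
  ⨆ u ∈ I.U x, I.infeasibility x u

/-- `u` is an optimal solution of the first subproblem at `x`. -/
def IsSP1Solution (x : Fin mx ⊕ Fin nx → ℝ) (u : Fin nu → ℝ) : Prop :=
  u ∈ I.U x ∧ I.infeasibility x u = I.etaF x

/-- `u` is an optimal solution of the second subproblem
`max_{u ∈ 𝒰(x)} min {c₂ y : y ∈ 𝒴(x,u)}` and `π` is an extreme point of `Π` that is a
corresponding optimal dual solution. -/
def IsSP2Solution (x : Fin mx ⊕ Fin nx → ℝ) (u : Fin nu → ℝ) (π : Fin ry → ℝ) : Prop :=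
  u ∈ I.U x ∧ I.recourseValue x u = I.worstCase x ∧
    π ∈ dualPoints I.B₂ I.c₂ ∧ ((I.rhs x u ⬝ᵥ π : ℝ) : EReal) = I.worstCase x

/-- `γ` spans an extreme ray of `Π` along which the third subproblem
`max {(d - B₁ x - E u)ᵀ π : π ∈ Π}` is unbounded. -/
def IsSP3Ray (x : Fin mx ⊕ Fin nx → ℝ) (u : Fin nu → ℝ) (γ : Fin ry → ℝ) : Prop :=
  γ ∈ extremeDirections (dualPolyhedron I.B₂ I.c₂) ∧ 0 < I.rhs x u ⬝ᵥ γ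

/-- The KKT system of `max {(-E u)ᵀ β : u ∈ 𝒰(x)}`; it defines both `𝒪𝒰(x,β)` and `𝒪𝒱(x,β)`. -/
def KKT (x : Fin mx ⊕ Fin nx → ℝ) (β : Fin ry → ℝ) : Set ((Fin nu → ℝ) × (Fin ru → ℝ)) :=
  {p | I.F x *ᵥ p.1 ≤ I.h + I.G *ᵥ x ∧
    -(I.Eᵀ *ᵥ β) ≤ (I.F x)ᵀ *ᵥ p.2 ∧
    p.2 * (I.h + I.G *ᵥ x - I.F x *ᵥ p.1) = 0 ∧
    p.1 * ((I.F x)ᵀ *ᵥ p.2 + I.Eᵀ *ᵥ β) = 0 ∧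
    0 ≤ p.1 ∧ 0 ≤ p.2}

/-- `(x, η)` can be completed by variables `(u^π, λ^π)`, `π ∈ P`, and `(v^γ, ζ^γ)`, `γ ∈ R`, to a
feasible point of the master problem defined by `P` and `R`. -/
def MasterFeasible (P R : Set (Fin ry → ℝ)) (x : Fin mx ⊕ Fin nx → ℝ) (η : ℝ) : Prop :=
  x ∈ I.X ∧
  (∀ π ∈ P, ∃ p ∈ I.KKT x π, π ⬝ᵥ I.d - π ⬝ᵥ (I.B₁ *ᵥ x) - π ⬝ᵥ (I.E *ᵥ p.1) ≤ η) ∧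
  (∀ γ ∈ R, ∃ p ∈ I.KKT x γ, γ ⬝ᵥ I.d - γ ⬝ᵥ (I.B₁ *ᵥ x) - γ ⬝ᵥ (I.E *ᵥ p.1) ≤ 0)

/-- `(x, η)` belongs to an optimal solution of the master problem, which minimizes `c₁ x + η`. -/
def MasterOptimal (P R : Set (Fin ry → ℝ)) (x : Fin mx ⊕ Fin nx → ℝ) (η : ℝ) : Prop :=
  I.MasterFeasible P R x η ∧
    ∀ x' η', I.MasterFeasible P R x' η' → I.c₁ ⬝ᵥ x + η ≤ I.c₁ ⬝ᵥ x' + η'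

/-- `x` and `LB` are a possible outcome of solving a feasible master problem: an optimal solution
with its value.  While there is no optimality cut (`P = ∅`), nothing bounds `η` from below and the
master problem is unbounded; then `LB = -∞` and `x` is the first-stage part of any feasible
point. -/
def MasterOutput (P R : Set (Fin ry → ℝ)) (x : Fin mx ⊕ Fin nx → ℝ) (LB : EReal) : Prop :=
  (∃ η : ℝ, I.MasterOptimal P R x η ∧ LB = ((I.c₁ ⬝ᵥ x + η : ℝ) : EReal)) ∨
  (P = ∅ ∧ (∃ η : ℝ, I.MasterFeasible P R x η) ∧ LB = ⊥)

end Data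

/-! ### The algorithm -/

/-- The memory of the algorithm between two iterations: both bounds, the extreme points and the
extreme directions collected so far, and the incumbent, a first-stage decision that attains the
upper bound. -/
structure State (mx nx ry : ℕ) where
  LB : EReal
  UB : EReal
  P : Set (Fin ry → ℝ)
  R : Set (Fin ry → ℝ)
  incumbent : Option (Fin mx ⊕ Fin nx → ℝ)

namespace Data

variable {mx nx nu ny rx ru ry : ℕ} (I : Data mx nx nu ny rx ru ry)

/-- Step 1. -/
noncomputable def initialState (mx nx ry : ℕ) : State mx nx ry where
  LB := ⊥
  UB := ⊤
  P := ∅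
  R := ∅
  incumbent := none

/-- Step 2, first alternative: the master problem is infeasible, the algorithm reports that the
two-stage problem is infeasible and terminates. -/
def ReportsInfeasible (s : State mx nx ry) : Prop :=
  ¬ ∃ x η, I.MasterFeasible s.P s.R x η

/-- Steps 3 and 4 at the first-stage decision `x`: the collected sets become `P'` and `R'`, and the
worst-case recourse cost of `x` is recorded as `ηs`. -/
def SubproblemStep (s : State mx nx ry) (x : Fin mx ⊕ Fin nx → ℝ)
    (P' R' : Set (Fin ry → ℝ)) (ηs : EReal) : Prop :=
  ∃ uf, I.IsSP1Solution x uf ∧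
    ((I.etaF x = 0 ∧ ∃ us π, I.IsSP2Solution x us π ∧
        P' = s.P ∪ {π} ∧ R' = s.R ∧ ηs = I.worstCase x) ∨
     (0 < I.etaF x ∧ ∃ γ, I.IsSP3Ray x uf γ ∧
        P' = s.P ∧ R' = s.R ∪ {γ} ∧ ηs = ⊤))

/-- Steps 2 to 5: one full iteration leads from the state `s` to the state `s'`.  All oracle answers
(optimal solutions, extreme points, extreme rays) are arbitrary among the admissible ones. -/
def Iteration (s s' : State mx nx ry) : Prop :=
  ∃ x ηs, I.MasterOutput s.P s.R x s'.LB ∧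
    I.SubproblemStep s x s'.P s'.R ηs ∧
    s'.UB = min s.UB (((I.c₁ ⬝ᵥ x : ℝ) : EReal) + ηs) ∧
    ((((I.c₁ ⬝ᵥ x : ℝ) : EReal) + ηs ≤ s.UB ∧ s'.incumbent = some x) ∨
     (s.UB < ((I.c₁ ⬝ᵥ x : ℝ) : EReal) + ηs ∧ s'.incumbent = s.incumbent))

/-- Step 6, first alternative: the iteration that starts in the state `s` ends in the state `s'`,
passes the termination test, and the incumbent `x` is returned. -/
def Returns (TOL : ℝ) (s s' : State mx nx ry) (x : Fin mx ⊕ Fin nx → ℝ) : Prop :=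
  I.Iteration s s' ∧ s'.UB - s'.LB ≤ (TOL : EReal) ∧ s'.incumbent = some x

/-- Step 6, second alternative: the iteration does not pass the termination test. -/
def Continues (TOL : ℝ) (s s' : State mx nx ry) : Prop :=
  I.Iteration s s' ∧ ¬ s'.UB - s'.LB ≤ (TOL : EReal)

/-- `I.Reaches TOL s₀ t s`: starting in the state `s₀`, the algorithm can be in the state `s` after
`t` further iterations, none of which terminated it. -/
inductive Reaches (TOL : ℝ) (s₀ : State mx nx ry) : ℕ → State mx nx ry → Prop
  | start : Reaches TOL s₀ 0 s₀
  | next {t : ℕ} {s s' : State mx nx ry} :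
      Reaches TOL s₀ t s → I.Continues TOL s s' → Reaches TOL s₀ (t + 1) s'

/-- `I.Runs TOL t s`: some run of the algorithm is in the state `s` after `t` iterations, none of
which terminated it. -/
def Runs (TOL : ℝ) (t : ℕ) (s : State mx nx ry) : Prop :=
  I.Reaches TOL (initialState mx nx ry) t s

/-- The master problem of the state `s` can be solved exactly: if it contains an optimality cut and
is feasible, its minimum is attained. -/
def MasterSolvable (s : State mx nx ry) : Prop :=
  s.P.Nonempty → (∃ x η, I.MasterFeasible s.P s.R x η) → ∃ x η, I.MasterOptimal s.P s.R x η

end Data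

end TwoStageDDU

namespace TwoStageDDU

/-! ### Farkas' lemma and linear programming duality -/

/-! By duality the recourse cost at `(x, u)` is the maximum of `(d - B₁x - Eu)ᵀπ` over Π, attained
at an extreme point when the recourse is feasible; infeasibility is witnessed by an extreme ray with
positive value. Neither Π nor its rays depend on `x` or `u`. A cut is therefore indexed by a point
or ray alone, and the KKT block re-optimizes the scenario for whatever `x` the master problem
considers.

Validity. Any KKT point lies in 𝒰(x), so weak duality makes every cut valid at a feasible `x` with η
its worst-case cost. The master problem is thus a relaxation (`masterFeasible_of_isFeasible`), which
gives LB ≤ w* and the correctness of an infeasibility report. UB is attained by a feasible incumbent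
once it is finite, so UB ≤ LB certifies optimality.

Progress. If the extreme point π found at `x` was already collected, its cut holds at the worst
scenario for π in 𝒰(x), so η is at least the true worst-case cost and the gap is closed
(`sub_nonpos_of_mem`). If a ray was already collected, its cut makes the ray's value nonpositive on
all of 𝒰(x), so it cannot be found again (`halfLine_notMem`). Each iteration that does not terminate
thus uses up a new point or ray.

Counting. An extreme point is fixed by `ry` independent active constraints out of `ny + ry`, an
extreme ray by `ry - 1`; Pascal's rule adds the two bounds. That the subproblems always have
admissible answers follows from compactness of 𝒰(x), strong duality and Krein–Milman on compact
faces. -/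

/-- Induction on the number of functionals: drop a redundant one, otherwise project along a
violating vector onto the kernel of the new one. This needs no topology. -/
theorem farkas_functionals {V ι : Type*} [AddCommGroup V] [Module ℝ V] (s : Finset ι)
    (a : ι → Module.Dual ℝ V) (b : Module.Dual ℝ V)
    (hab : ∀ v, (∀ i ∈ s, a i v ≤ 0) → b v ≤ 0) :
    ∃ w : ι → ℝ, (∀ i, 0 ≤ w i) ∧ b = ∑ i ∈ s, w i • a i := by
  classical
  induction s using Finset.induction_on generalizing a b with
  | empty =>
    refine ⟨0, by simp, ?_⟩
    ext v
    have h₁ := hab v (by simp)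
    have h₂ := hab (-v) (by simp)
    simp only [map_neg] at h₂
    simpa using le_antisymm h₁ (by linarith)
  | insert k s hk ih =>
    by_cases hs : ∀ v, (∀ i ∈ s, a i v ≤ 0) → b v ≤ 0
    · obtain ⟨w, hw, rfl⟩ := ih a b hs
      refine ⟨Function.update w k 0, fun i => ?_, ?_⟩
      · rcases eq_or_ne i k with rfl | hi
        · simp
        · simpa [hi] using hw i
      · rw [Finset.sum_insert hk]
        simp only [Function.update_self, zero_smul, zero_add]
        refine Finset.sum_congr rfl fun i hi => ?_
        rw [Function.update_of_ne (by rintro rfl; exact hk hi)]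
    · push Not at hs
      obtain ⟨v₀, hv₀, hb₀⟩ := hs
      have hk₀ : 0 < a k v₀ := by
        by_contra! h
        refine absurd (hab v₀ fun i hi => ?_) (not_le.2 hb₀)
        rcases Finset.mem_insert.1 hi with rfl | hi
        exacts [h, hv₀ i hi]
      -- These are `a i` and `b` composed with the projection onto `ker (a k)` along `v₀`. Undoing
      -- the projection gives `a k` a nonnegative coefficient, because `b v₀ > 0` and `a i v₀ ≤ 0`.
      obtain ⟨w, hw, hbw⟩ := ih (fun i => a i - (a i v₀ / a k v₀) • a k)
        (b - (b v₀ / a k v₀) • a k) (by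
          intro v hv
          have := hab (v - (a k v / a k v₀) • v₀) (by
            intro i hi
            rcases Finset.mem_insert.1 hi with rfl | hi
            · simp [hk₀.ne']
            · have := hv i hi
              simp only [LinearMap.sub_apply, LinearMap.smul_apply, smul_eq_mul, map_sub,
                map_smul] at this ⊢
              calc _ = _ := by ring
                _ ≤ 0 := this)
          simp only [LinearMap.sub_apply, LinearMap.smul_apply, smul_eq_mul, map_sub,
            map_smul] at this ⊢
          calc _ = _ := by ring
            _ ≤ 0 := this)
      have hsum : ∑ i ∈ s, w i * (a i v₀ / a k v₀) ≤ 0 :=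
        Finset.sum_nonpos fun i hi => mul_nonpos_of_nonneg_of_nonpos (hw i)
          (div_nonpos_of_nonpos_of_nonneg (hv₀ i hi) hk₀.le)
      refine ⟨Function.update w k (b v₀ / a k v₀ - ∑ i ∈ s, w i * (a i v₀ / a k v₀)),
        fun i => ?_, ?_⟩
      · rcases eq_or_ne i k with rfl | hi
        · simp only [Function.update_self]
          have : 0 < b v₀ / a i v₀ := div_pos hb₀ hk₀
          linarith
        · simpa [hi] using hw i
      · rw [Finset.sum_insert hk, Function.update_self,
          Finset.sum_congr rfl (g := fun i => w i • a i) fun i hi => by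
            rw [Function.update_of_ne (by rintro rfl; exact hk hi)]]
        rw [sub_eq_iff_eq_add] at hbw
        refine hbw.trans (LinearMap.ext fun v => ?_)
        simp only [LinearMap.add_apply, LinearMap.sum_apply, LinearMap.smul_apply,
          LinearMap.sub_apply, smul_eq_mul, mul_sub, Finset.sum_sub_distrib, ← mul_assoc,
          ← Finset.sum_mul]
        ring

/-- Farkas' lemma for the system `c ≤ Aᵀ y`, `0 ≤ y`. -/
theorem farkas_matrix {m n : Type*} [Fintype m] [Fintype n] (A : Matrix m n ℝ) (c : n → ℝ)
    (hc : ∀ v, 0 ≤ v → A *ᵥ v ≤ 0 → c ⬝ᵥ v ≤ 0) : ∃ y, 0 ≤ y ∧ c ≤ Aᵀ *ᵥ y := by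
  classical
  obtain ⟨w, hw, hcw⟩ := farkas_functionals Finset.univ
    (Sum.elim (fun i : m => LinearMap.proj i ∘ₗ A.mulVecLin)
      (fun j : n => -(LinearMap.proj j : (n → ℝ) →ₗ[ℝ] ℝ)))
    (dotProductBilin ℝ ℝ c) (by
      intro v hv
      refine hc v (fun j => ?_) (fun i => ?_)
      · simpa using hv (Sum.inr j) (Finset.mem_univ _)
      · simpa using hv (Sum.inl i) (Finset.mem_univ _))
  refine ⟨fun i => w (Sum.inl i), fun i => hw _, fun j => ?_⟩
  have := congrArg (fun f => f (Pi.single j 1)) hcw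
  simp [Fintype.sum_sum_type, Pi.single_apply] at this
  rw [this]
  have h := hw (Sum.inr j)
  simp [Matrix.mulVec, dotProduct, mul_comm, h]

section LinearProgram

variable {m n : Type*} [Fintype m] [Fintype n] {A : Matrix m n ℝ} {b : m → ℝ} {c : n → ℝ}

theorem lp_weak_duality {x : n → ℝ} {y : m → ℝ} (hx : 0 ≤ x) (hAx : A *ᵥ x ≤ b) (hy : 0 ≤ y)
    (hAy : c ≤ Aᵀ *ᵥ y) : c ⬝ᵥ x ≤ b ⬝ᵥ y :=
  calc c ⬝ᵥ x ≤ (Aᵀ *ᵥ y) ⬝ᵥ x := dotProduct_le_dotProduct_of_nonneg_right hAy hx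
    _ = (A *ᵥ x) ⬝ᵥ y := by
      rw [Matrix.mulVec_transpose, ← Matrix.dotProduct_mulVec, dotProduct_comm]
    _ ≤ b ⬝ᵥ y := dotProduct_le_dotProduct_of_nonneg_right hAx hy

/-- Strong duality: if both programs are feasible, then both have optimal solutions with the same
value. -/
theorem lp_strong_duality (hP : ∃ x, 0 ≤ x ∧ A *ᵥ x ≤ b) (hD : ∃ y, 0 ≤ y ∧ c ≤ Aᵀ *ᵥ y) :
    ∃ x y, 0 ≤ x ∧ A *ᵥ x ≤ b ∧ 0 ≤ y ∧ c ≤ Aᵀ *ᵥ y ∧ c ⬝ᵥ x = b ⬝ᵥ y := by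
  obtain ⟨x₀, hx₀, hAx₀⟩ := hP
  obtain ⟨y₀, hy₀, hAy₀⟩ := hD
  -- A single Farkas system in `z = (y, x)` encodes dual feasibility, primal feasibility and `b ⬝ᵥ y
  -- ≤ c ⬝ᵥ x`; the last is the `Unit` row of the transpose.
  obtain ⟨z, hz, hAz⟩ := farkas_matrix
    (Matrix.of (Sum.elim (fun i : m => Sum.elim (A i) (Sum.elim 0 fun _ : Unit => -b i))
      (fun j : n => Sum.elim 0 (Sum.elim (fun i : m => -A i j) fun _ => c j))))
    (Sum.elim c (Sum.elim (-b) 0)) (by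
      intro v hv hAv
      set p : n → ℝ := fun j => v (Sum.inl j)
      set q : m → ℝ := fun i => v (Sum.inr (Sum.inl i))
      set t : ℝ := v (Sum.inr (Sum.inr ()))
      have hp : 0 ≤ p := fun j => hv _
      have hq : 0 ≤ q := fun i => hv _
      have ht : 0 ≤ t := hv _
      have h₁ : A *ᵥ p ≤ t • b := fun i => by
        have := hAv (Sum.inl i)
        simp [Matrix.mulVec, dotProduct, Fintype.sum_sum_type] at this ⊢
        linarith
      have h₂ : t • c ≤ Aᵀ *ᵥ q := fun j => by
        have := hAv (Sum.inr j)
        simp [Matrix.mulVec, dotProduct, Fintype.sum_sum_type] at this ⊢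
        linarith
      have hgoal : Sum.elim c (Sum.elim (-b) 0) ⬝ᵥ v = c ⬝ᵥ p - b ⬝ᵥ q := by
        simp [dotProduct, Fintype.sum_sum_type, p, q, sub_eq_add_neg]
      rw [hgoal]
      -- For `t = 0` the vectors `p`, `q` are recession directions, and weak duality against the
      -- given feasible points yields `c ⬝ᵥ p ≤ 0 ≤ b ⬝ᵥ q`. For `t > 0` weak duality for the data
      -- scaled by `t` suffices.
      rcases ht.eq_or_lt with ht | ht
      · rw [← ht, zero_smul] at h₁ h₂
        have e₁ := lp_weak_duality hp h₁ hy₀ hAy₀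
        have e₂ := lp_weak_duality hx₀ hAx₀ hq h₂
        rw [zero_dotProduct] at e₁ e₂
        linarith
      · have := lp_weak_duality hp h₁ hq h₂
        have e : t * (c ⬝ᵥ p) ≤ t * (b ⬝ᵥ q) := by simpa [smul_dotProduct] using this
        linarith [le_of_mul_le_mul_left e ht])
  refine ⟨fun j => z (Sum.inr j), fun i => z (Sum.inl i), fun j => hz _, fun i => ?_,
    fun i => hz _, fun j => ?_, ?_⟩
  · have := hAz (Sum.inr (Sum.inl i))
    simp [Matrix.mulVec, dotProduct, Fintype.sum_sum_type] at this ⊢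
    linarith
  · have := hAz (Sum.inl j)
    simpa [Matrix.mulVec, dotProduct, Fintype.sum_sum_type] using this
  · refine le_antisymm (lp_weak_duality (A := A) (fun j => hz _) (fun i => ?_) (fun i => hz _)
      (fun j => ?_)) ?_
    · have := hAz (Sum.inr (Sum.inl i))
      simp [Matrix.mulVec, dotProduct, Fintype.sum_sum_type] at this ⊢
      linarith
    · have := hAz (Sum.inl j)
      simpa [Matrix.mulVec, dotProduct, Fintype.sum_sum_type] using this
    · have := hAz (Sum.inr (Sum.inr ()))
      simp [Matrix.mulVec, dotProduct, Fintype.sum_sum_type] at this ⊢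
      linarith

/-- The two nonnegative slack products telescope to the duality gap, which is zero, so each summand
vanishes. -/
theorem lp_complementary_slackness {x : n → ℝ} {y : m → ℝ} (hx : 0 ≤ x) (hAx : A *ᵥ x ≤ b)
    (hy : 0 ≤ y) (hAy : c ≤ Aᵀ *ᵥ y) (h : c ⬝ᵥ x = b ⬝ᵥ y) :
    y * (b - A *ᵥ x) = 0 ∧ x * (Aᵀ *ᵥ y - c) = 0 := by
  have hy' : 0 ≤ y * (b - A *ᵥ x) := mul_nonneg hy (sub_nonneg.2 hAx)
  have hx' : 0 ≤ x * (Aᵀ *ᵥ y - c) := mul_nonneg hx (sub_nonneg.2 hAy)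
  have e : y ⬝ᵥ (b - A *ᵥ x) + x ⬝ᵥ (Aᵀ *ᵥ y - c) = 0 := by
    rw [dotProduct_sub, dotProduct_sub, Matrix.mulVec_transpose, dotProduct_comm x (y ᵥ* A),
      ← Matrix.dotProduct_mulVec, dotProduct_comm x c, h, dotProduct_comm y b]
    ring
  have e₁ : 0 ≤ ∑ i, (y * (b - A *ᵥ x)) i := Finset.sum_nonneg fun i _ => hy' i
  have e₂ : 0 ≤ ∑ j, (x * (Aᵀ *ᵥ y - c)) j := Finset.sum_nonneg fun j _ => hx' j
  have e₃ : ∑ i, (y * (b - A *ᵥ x)) i + ∑ j, (x * (Aᵀ *ᵥ y - c)) j = 0 := e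
  constructor
  · funext i
    exact (Finset.sum_eq_zero_iff_of_nonneg fun i _ => hy' i).1 (by linarith) i
      (Finset.mem_univ i)
  · funext j
    exact (Finset.sum_eq_zero_iff_of_nonneg fun j _ => hx' j).1 (by linarith) j
      (Finset.mem_univ j)

end LinearProgram

/-! ### Counting extreme points and extreme rays -/

section Counting

variable {V ι : Type*} [AddCommGroup V] [Module ℝ V]

/-- Active constraints do not change along `v`, and the finitely many inactive ones have slack to
spare. -/
theorem exists_small_perturbation [Finite ι] {a : ι → Module.Dual ℝ V} {b : ι → ℝ} {z v : V}
    (hz : ∀ i, a i z ≤ b i) (hv : ∀ i, a i z = b i → a i v = 0) :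
    ∃ ε : ℝ, 0 < ε ∧ ∀ i, a i (z + ε • v) ≤ b i ∧ a i (z - ε • v) ≤ b i := by
  have h : ∀ i, ∀ᶠ ε : ℝ in nhdsWithin 0 (Set.Ioi 0), a i z + ε * |a i v| ≤ b i := by
    intro i
    rcases (hz i).eq_or_lt with hi | hi
    · simp [hv i hi, hi]
    · have hcont : Filter.Tendsto (fun ε : ℝ => a i z + ε * |a i v|) (nhdsWithin 0 (Set.Ioi 0))
          (nhds (a i z + 0 * |a i v|)) :=
        (Continuous.tendsto (by fun_prop) 0).mono_left nhdsWithin_le_nhds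
      exact hcont.eventually_le_const (by simpa using hi)
  obtain ⟨ε, hε, hpos⟩ := ((Filter.eventually_all.2 h).and self_mem_nhdsWithin).exists
  have hpos : 0 < ε := hpos
  refine ⟨ε, hpos, fun i => ?_⟩
  have h₁ := mul_le_mul_of_nonneg_left (le_abs_self (a i v)) hpos.le
  have h₂ := mul_le_mul_of_nonneg_left (neg_abs_le (a i v)) hpos.le
  simp only [map_add, map_sub, map_smul, smul_eq_mul]
  constructor <;> linarith [hε i]

/-- A set each of whose elements is determined by a `k`-element subset of `ι`. -/
theorem finite_and_ncard_le_choose [Fintype ι] {α : Type*} {s : Set α} {k : ℕ}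
    (T : α → Finset ι)
    (hcard : ∀ x ∈ s, (T x).card = k) (hinj : Set.InjOn T s) :
    s.Finite ∧ s.ncard ≤ (Fintype.card ι).choose k := by
  classical
  have hmaps : Set.MapsTo T s (Finset.powersetCard k (Finset.univ : Finset ι) : Set _) :=
    fun x hx => by simp [hcard x hx]
  refine ⟨Set.Finite.of_injOn hmaps hinj (Finset.finite_toSet _), ?_⟩
  have := Set.ncard_le_ncard_of_injOn T hmaps hinj (Finset.finite_toSet _)
  simpa [Set.ncard_coe_finset] using this

variable [FiniteDimensional ℝ V]

theorem finrank_inf_ker_add_one {W : Submodule ℝ V} {f : Module.Dual ℝ V}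
    (h : ¬ W ≤ LinearMap.ker f) :
    Module.finrank ℝ ↥(W ⊓ LinearMap.ker f) + 1 = Module.finrank ℝ W := by
  have hf : f ∘ₗ W.subtype ≠ 0 := by
    intro h₀
    exact h fun x hx => by simpa using LinearMap.congr_fun h₀ ⟨x, hx⟩
  rw [← Module.Dual.finrank_ker_add_one_of_ne_zero hf, ← Submodule.map_comap_subtype,
    Submodule.finrank_map_subtype_eq, LinearMap.ker_comp]

/-- Among finitely many linear equations one can select as many independent ones as the codimension
of the solution space. -/
theorem exists_independent_equations [DecidableEq ι] (a : ι → Module.Dual ℝ V) (S : Finset ι) :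
    ∃ T ⊆ S, (⨅ i ∈ T, LinearMap.ker (a i)) = ⨅ i ∈ S, LinearMap.ker (a i) ∧
      T.card + Module.finrank ℝ ↥(⨅ i ∈ T, LinearMap.ker (a i)) = Module.finrank ℝ V := by
  induction S using Finset.induction_on with
  | empty => exact ⟨∅, subset_rfl, rfl, by
      rw [show (⨅ i ∈ (∅ : Finset ι), LinearMap.ker (a i)) = ⊤ by simp, finrank_top]; simp⟩
  | insert k S hk ih =>
    obtain ⟨T, hTS, hT, hcard⟩ := ih
    by_cases h : (⨅ i ∈ T, LinearMap.ker (a i)) ≤ LinearMap.ker (a k)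
    · exact ⟨T, hTS.trans (Finset.subset_insert k S), by
        rw [Finset.iInf_insert, ← hT, inf_eq_right.2 h], hcard⟩
    · have hkT : k ∉ T := fun hkT => h (iInf₂_le k hkT)
      refine ⟨insert k T, Finset.insert_subset_insert k hTS, by
        rw [Finset.iInf_insert, Finset.iInf_insert, hT], ?_⟩
      rw [Finset.card_insert_of_notMem hkT, Finset.iInf_insert, inf_comm, ← hcard,
        ← finrank_inf_ker_add_one h]
      ring

/-- A direction annihilated by all active constraints could be added and subtracted, contradicting
extremality. Hence `finrank ℝ V` independent active equations determine the point. -/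
theorem extremePoints_polyhedron_finite [Fintype ι] (a : ι → Module.Dual ℝ V) (b : ι → ℝ) :
    (Set.extremePoints ℝ {z | ∀ i, a i z ≤ b i}).Finite ∧
      (Set.extremePoints ℝ {z | ∀ i, a i z ≤ b i}).ncard
        ≤ (Fintype.card ι).choose (Module.finrank ℝ V) := by
  classical
  have key : ∀ z ∈ Set.extremePoints ℝ {z | ∀ i, a i z ≤ b i}, ∃ T : Finset ι,
      T.card = Module.finrank ℝ V ∧ (∀ i ∈ T, a i z = b i) ∧
        (⨅ i ∈ T, LinearMap.ker (a i)) = ⊥ := by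
    rintro z ⟨hz, hext⟩
    obtain ⟨T, hTS, hT, hcard⟩ := exists_independent_equations a {i | a i z = b i}
    have hbot : (⨅ i ∈ T, LinearMap.ker (a i)) = ⊥ := by
      rw [hT, eq_bot_iff]
      intro v hv
      simp only [Submodule.mem_iInf, LinearMap.mem_ker, Finset.mem_filter_univ] at hv
      obtain ⟨ε, hε, h⟩ := exists_small_perturbation hz hv
      have := hext (fun i => (h i).1) (fun i => (h i).2)
        ⟨1 / 2, 1 / 2, by norm_num, by norm_num, by norm_num, by module⟩
      simpa [hε.ne'] using this
    refine ⟨T, ?_, fun i hi => by simpa using hTS hi, hbot⟩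
    rwa [hbot, finrank_bot, add_zero] at hcard
  choose! T hcard hact hbot using key
  refine finite_and_ncard_le_choose T hcard fun z hz z' hz' h => ?_
  have : z - z' ∈ ⨅ i ∈ T z, LinearMap.ker (a i) := by
    simp only [Submodule.mem_iInf, LinearMap.mem_ker, map_sub]
    intro i hi
    rw [hact z hz i hi, hact z' hz' i (h ▸ hi), sub_self]
  rw [hbot z hz, Submodule.mem_bot] at this
  exact sub_eq_zero.1 this

end Counting

section Rays

variable {r : ℕ}

theorem self_mem_halfLine (γ : Fin r → ℝ) : γ ∈ halfLine γ := ⟨1, by simp⟩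

theorem halfLine_smul {t : ℝ} (ht : 0 < t) (γ : Fin r → ℝ) : halfLine (t • γ) = halfLine γ := by
  ext δ
  constructor
  · rintro ⟨s, hs, rfl⟩
    exact ⟨s * t, by positivity, by rw [smul_smul]⟩
  · rintro ⟨s, hs, rfl⟩
    exact ⟨s / t, by positivity, by rw [smul_smul, div_mul_cancel₀ _ ht.ne']⟩

/-- On an extreme ray the active constraints cut out exactly the line through it, so `r` independent
ones determine that line. The ambient dimension is written `r + 1` to avoid truncated subtraction.
-/
theorem extremeHalfLines_polyhedralCone_finite {ι : Type*} [Fintype ι] {r : ℕ}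
    (a : ι → Module.Dual ℝ (Fin (r + 1) → ℝ))
    (hpointed : ∀ z, (∀ i, a i z ≤ 0) → (∀ i, a i (-z) ≤ 0) → z = 0) :
    (halfLine '' {z | z ≠ 0 ∧ IsExtreme ℝ {z | ∀ i, a i z ≤ 0} (halfLine z)}).Finite ∧
      (halfLine '' {z | z ≠ 0 ∧ IsExtreme ℝ {z | ∀ i, a i z ≤ 0} (halfLine z)}).ncard
        ≤ (Fintype.card ι).choose r := by
  classical
  have key : ∀ ρ ∈ halfLine '' {z | z ≠ 0 ∧ IsExtreme ℝ {z | ∀ i, a i z ≤ 0} (halfLine z)},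
      ∃ (z : Fin (r + 1) → ℝ) (T : Finset ι), z ≠ 0 ∧ (∀ i, a i z ≤ 0) ∧ ρ = halfLine z ∧
        T.card = r ∧ (⨅ i ∈ T, LinearMap.ker (a i)) = Submodule.span ℝ {z} := by
    rintro _ ⟨z, ⟨hz₀, hext⟩, rfl⟩
    have hz : ∀ i, a i z ≤ 0 := hext.subset (self_mem_halfLine z)
    obtain ⟨T, -, hT, hcard⟩ := exists_independent_equations a {i | a i z = 0}
    have hspan : (⨅ i ∈ T, LinearMap.ker (a i)) = Submodule.span ℝ {z} := by
      rw [hT]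
      apply le_antisymm
      · intro v hv
        simp only [Submodule.mem_iInf, LinearMap.mem_ker, Finset.mem_filter_univ] at hv
        obtain ⟨ε, hε, h⟩ := exists_small_perturbation (b := fun _ => 0) hz hv
        obtain ⟨t, -, ht⟩ := hext.left_mem_of_mem_openSegment (fun i => (h i).1)
          (fun i => (h i).2) (self_mem_halfLine z)
          ⟨1 / 2, 1 / 2, by norm_num, by norm_num, by norm_num, by module⟩
        refine Submodule.mem_span_singleton.2 ⟨ε⁻¹ * (t - 1), ?_⟩
        rw [mul_smul, sub_smul, ← ht, one_smul, add_sub_cancel_left, smul_smul,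
          inv_mul_cancel₀ hε.ne', one_smul]
      · rw [Submodule.span_singleton_le_iff_mem]
        simp
    refine ⟨z, T, hz₀, hz, rfl, ?_, hspan⟩
    rw [hspan, finrank_span_singleton hz₀] at hcard
    simpa using hcard
  choose! z T hz₀ hz hρ hcard hspan using key
  refine finite_and_ncard_le_choose T hcard fun ρ h₁ ρ' h₂ h => ?_
  have hmem : z ρ' ∈ Submodule.span ℝ {z ρ} := by
    rw [← hspan ρ h₁, h, hspan ρ' h₂]
    exact Submodule.mem_span_singleton_self _
  obtain ⟨t, ht⟩ := Submodule.mem_span_singleton.1 hmem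
  rw [hρ ρ h₁, hρ ρ' h₂, ← ht]
  rcases lt_trichotomy t 0 with ht₀ | rfl | ht₀
  -- The same line could carry two opposite rays; pointedness rules this out.
  · refine absurd (hpointed _ (hz ρ h₁) fun i => ?_) (hz₀ ρ h₁)
    have := hz ρ' h₂ i
    rw [← ht, map_smul, smul_eq_mul] at this
    rw [map_neg]
    nlinarith
  · exact absurd (by simpa using ht.symm) (hz₀ ρ' h₂)
  · exact (halfLine_smul ht₀ _).symm

end Rays

/-! ### The recourse dual polyhedron -/

section DualPolyhedron

variable {ny ry : ℕ} {B₂ : Matrix (Fin ry) (Fin ny) ℝ} {c₂ : Fin ny → ℝ}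

theorem dualPolyhedron_zero_smul_add {π γ : Fin ry → ℝ} (hπ : π ∈ dualPolyhedron B₂ c₂)
    (hγ : γ ∈ dualPolyhedron B₂ 0) : π + γ ∈ dualPolyhedron B₂ c₂ := by
  refine ⟨?_, add_nonneg hπ.2 hγ.2⟩
  rw [Matrix.mulVec_add]
  simpa using add_le_add hπ.1 hγ.1

theorem smul_mem_dualPolyhedron_zero {t : ℝ} (ht : 0 ≤ t) {γ : Fin ry → ℝ}
    (hγ : γ ∈ dualPolyhedron B₂ 0) : t • γ ∈ dualPolyhedron B₂ 0 := by
  refine ⟨?_, smul_nonneg ht hγ.2⟩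
  rw [Matrix.mulVec_smul]
  exact smul_nonpos_of_nonneg_of_nonpos ht hγ.1

theorem nonpos_of_forall_add_mul_le {p q s : ℝ} (h : ∀ t : ℝ, 0 ≤ t → p + t * q ≤ s) : q ≤ 0 := by
  by_contra! hq
  have h₀ := h 0 le_rfl
  have := h ((s - p + 1) / q) (div_nonneg (by linarith) hq.le)
  rw [div_mul_cancel₀ _ hq.ne'] at this
  linarith

/-- Nonemptiness matters: by definition the recession cone of the empty set is the whole space. -/
theorem recessionCone_dualPolyhedron (h : (dualPolyhedron B₂ c₂).Nonempty) :
    recessionCone (dualPolyhedron B₂ c₂) = dualPolyhedron B₂ 0 := by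
  apply Set.Subset.antisymm
  · intro γ hγ
    obtain ⟨π, hπ⟩ := h
    have key := hγ π hπ
    refine ⟨fun j => ?_, fun i => ?_⟩
    · refine nonpos_of_forall_add_mul_le (p := (B₂ᵀ *ᵥ π) j) (s := c₂ j) fun t ht => ?_
      have := (key t ht).1 j
      rwa [Matrix.mulVec_add, Matrix.mulVec_smul] at this
    · have : -γ i ≤ 0 := by
        refine nonpos_of_forall_add_mul_le (p := -π i) (s := 0) fun t ht => ?_
        have := (key t ht).2 i
        simp only [Pi.zero_apply, Pi.add_apply, Pi.smul_apply, smul_eq_mul] at this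
        linarith
      simpa using this
  · exact fun γ hγ π hπ t ht =>
      dualPolyhedron_zero_smul_add hπ (smul_mem_dualPolyhedron_zero ht hγ)

/-- The constraints that define `dualPolyhedron B₂ c₂`, as linear functionals. -/
def dualConstraints (B₂ : Matrix (Fin ry) (Fin ny) ℝ) :
    Fin ny ⊕ Fin ry → Module.Dual ℝ (Fin ry → ℝ) :=
  Sum.elim (fun j => LinearMap.proj j ∘ₗ B₂ᵀ.mulVecLin) fun i => -LinearMap.proj i

theorem dualPolyhedron_eq_setOf (c₂ : Fin ny → ℝ) :
    dualPolyhedron B₂ c₂ = {π | ∀ i, dualConstraints B₂ i π ≤ Sum.elim c₂ 0 i} := by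
  ext π
  simp [dualPolyhedron, dualConstraints, Pi.le_def, Matrix.mulVec_transpose]

theorem dualPoints_finite (B₂ : Matrix (Fin ry) (Fin ny) ℝ) (c₂ : Fin ny → ℝ) :
    (dualPoints B₂ c₂).Finite ∧ (dualPoints B₂ c₂).ncard ≤ (ny + ry).choose ry := by
  have := extremePoints_polyhedron_finite (dualConstraints B₂) (Sum.elim c₂ 0)
  rw [← dualPolyhedron_eq_setOf] at this
  simpa [dualPoints] using this

theorem dualRays_finite (h : (dualPolyhedron B₂ c₂).Nonempty) :
    (dualRays B₂ c₂).Finite ∧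
      (dualRays B₂ c₂).ncard + (ny + ry).choose ry ≤ (ny + ry + 1).choose ry ∧
      (ry ≤ ny + 1 → (dualRays B₂ c₂).ncard ≤ (ny + ry).choose ry) := by
  rw [dualRays, extremeRays, extremeDirections, recessionCone_dualPolyhedron h]
  cases ry with
  | zero =>
    have : {γ : Fin 0 → ℝ | γ ≠ 0 ∧ IsExtreme ℝ (dualPolyhedron B₂ 0) (halfLine γ)} = ∅ :=
      Set.eq_empty_of_forall_notMem fun γ hγ => hγ.1 (Subsingleton.elim _ _)
    rw [this]
    simp
  | succ r =>
    have key := extremeHalfLines_polyhedralCone_finite (dualConstraints B₂) (by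
      intro z h₁ h₂
      funext i
      have e₁ := h₁ (Sum.inr i)
      have e₂ := h₂ (Sum.inr i)
      simp [dualConstraints] at e₁ e₂
      exact le_antisymm e₂ e₁)
    have e := dualPolyhedron_eq_setOf (B₂ := B₂) 0
    simp only [Sum.elim_zero_zero, Pi.zero_apply] at e
    rw [← e] at key
    simp only [Fintype.card_sum, Fintype.card_fin] at key
    refine ⟨key.1, ?_, fun hr => key.2.trans ?_⟩
    · rw [Nat.choose_succ_succ]
      exact Nat.add_le_add_right key.2 _
    -- The ratio of the two consecutive binomial coefficients is `(ny + 1) / (r + 1)`, which is at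
    -- least one under the hypothesis.
    · have h₁ := Nat.choose_succ_right_eq (ny + (r + 1)) r
      have h₂ : r + 1 ≤ ny + (r + 1) - r := by omega
      refine Nat.le_of_mul_le_mul_right (c := r + 1) ?_ (by omega)
      rw [h₁]
      exact Nat.mul_le_mul_left _ h₂

end DualPolyhedron

/-! ### Extreme points and extreme rays that maximize a linear function -/

/-- A convex combination with positive weights reaches the upper bound only if both endpoints do. -/
theorem extremePoints_face_subset {V : Type*} [AddCommGroup V] [Module ℝ V] {S : Set V}
    {f : Module.Dual ℝ V} {μ : ℝ} (hf : ∀ x ∈ S, f x ≤ μ) :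
    Set.extremePoints ℝ {x ∈ S | f x = μ} ⊆ Set.extremePoints ℝ S := by
  rintro z ⟨⟨hzS, hz⟩, hext⟩
  refine ⟨hzS, fun x hx y hy hzxy => ?_⟩
  obtain ⟨a, b, ha, hb, hab, h⟩ := id hzxy
  have e : a * f x + b * f y = μ := by
    rw [← hz, ← h]
    simp
  have hx' := hf x hx
  have hy' := hf y hy
  have e₁ : a * (μ - f x) + b * (μ - f y) = 0 := by
    calc _ = (a + b) * μ - (a * f x + b * f y) := by ring
      _ = 0 := by rw [hab, e]; ring
  have p₁ : 0 ≤ a * (μ - f x) := mul_nonneg ha.le (by linarith)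
  have p₂ : 0 ≤ b * (μ - f y) := mul_nonneg hb.le (by linarith)
  have q₁ : a * (μ - f x) = 0 := by linarith
  have q₂ : b * (μ - f y) = 0 := by linarith
  have r₁ := (mul_eq_zero.1 q₁).resolve_left ha.ne'
  have r₂ := (mul_eq_zero.1 q₂).resolve_left hb.ne'
  exact hext ⟨hx, by linarith⟩ ⟨hy, by linarith⟩ hzxy

section

variable {ny ry : ℕ} {B₂ : Matrix (Fin ry) (Fin ny) ℝ} {c₂ : Fin ny → ℝ}

theorem isClosed_dualPolyhedron : IsClosed (dualPolyhedron B₂ c₂) :=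
  (isClosed_le (f := fun π : Fin ry → ℝ => B₂ᵀ *ᵥ π) (by fun_prop) continuous_const).inter
    (isClosed_le continuous_const continuous_id)

theorem isCompact_of_nonneg_of_sum_le {S : Set (Fin ry → ℝ)} (hS : IsClosed S) {μ : ℝ}
    (h : ∀ π ∈ S, 0 ≤ π ∧ ∑ i, π i ≤ μ) : IsCompact S := by
  refine (isCompact_Icc (a := (0 : Fin ry → ℝ)) (b := fun _ => μ)).of_isClosed_subset hS
    fun π hπ => ⟨(h π hπ).1, fun i => ?_⟩
  exact (Finset.single_le_sum (f := π) (fun j _ => (h π hπ).1 j) (Finset.mem_univ i)).trans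
    (h π hπ).2

/-- The functional `q ⬝ᵥ ·`. -/
noncomputable def dotFunctional (q : Fin ry → ℝ) : Module.Dual ℝ (Fin ry → ℝ) :=
  dotProductBilin ℝ ℝ q

@[simp] theorem dotFunctional_apply (q π : Fin ry → ℝ) : dotFunctional q π = q ⬝ᵥ π := rfl

/-- The optimal face may be unbounded, so Krein–Milman does not apply to it directly. Minimizing the
coordinate sum over it selects a subface, compact because `π ≥ 0`; extreme points of a face of a
face are extreme in Π. -/
theorem exists_dualPoint_of_isMax {q π₀ : Fin ry → ℝ} (hπ₀ : π₀ ∈ dualPolyhedron B₂ c₂)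
    (hmax : ∀ π ∈ dualPolyhedron B₂ c₂, q ⬝ᵥ π ≤ q ⬝ᵥ π₀) :
    ∃ π ∈ dualPoints B₂ c₂, q ⬝ᵥ π = q ⬝ᵥ π₀ := by
  set M : Set (Fin ry → ℝ) := {π ∈ dualPolyhedron B₂ c₂ | dotFunctional q π = q ⬝ᵥ π₀} with hM
  have hMclosed : IsClosed M :=
    isClosed_dualPolyhedron.inter
      (isClosed_eq (f := fun π => q ⬝ᵥ π) (by fun_prop) continuous_const)
  -- Truncating at the coordinate sum of `π₀` makes the minimum attained without changing it.
  have hcompact : IsCompact (M ∩ {π | ∑ i, π i ≤ ∑ i, π₀ i}) :=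
    isCompact_of_nonneg_of_sum_le
      (hMclosed.inter (isClosed_le (by fun_prop) continuous_const))
      fun π hπ => ⟨hπ.1.1.2, hπ.2⟩
  obtain ⟨π₁, hπ₁, hmin⟩ := hcompact.exists_isMinOn ⟨π₀, ⟨hπ₀, rfl⟩, le_refl (∑ i, π₀ i)⟩
    (f := fun π => ∑ i, π i) (by fun_prop)
  have hneg : ∀ π : Fin ry → ℝ, dotFunctional (-1) π = -∑ i, π i := fun π => by
    simp [dotProduct]
  have hminM : ∀ π ∈ M, dotFunctional (-1) π ≤ dotFunctional (-1) π₁ := by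
    intro π hπ
    rw [hneg, hneg, neg_le_neg_iff]
    rcases le_total (∑ i, π i) (∑ i, π₀ i) with h | h
    · exact hmin ⟨hπ, h⟩
    · exact le_trans hπ₁.2 h
  have hface : IsCompact {π ∈ M | dotFunctional (-1) π = dotFunctional (-1) π₁} := by
    refine isCompact_of_nonneg_of_sum_le (μ := ∑ i, π₁ i) (hMclosed.inter
      (isClosed_eq (f := fun π : Fin ry → ℝ => (-1 : Fin ry → ℝ) ⬝ᵥ π) (by fun_prop)
        continuous_const)) ?_
    rintro π ⟨hπ, h⟩
    rw [hneg, hneg, neg_inj] at h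
    exact ⟨hπ.1.2, h.le⟩
  obtain ⟨π, hπ⟩ := hface.extremePoints_nonempty ⟨π₁, hπ₁.1, rfl⟩
  have hπM := extremePoints_face_subset hminM hπ
  exact ⟨π, extremePoints_face_subset hmax hπM, (extremePoints_subset hπM).2⟩

theorem eq_zero_of_nonneg_of_sum_eq_zero {x : Fin ry → ℝ} (hx : 0 ≤ x) (h : ∑ i, x i = 0) :
    x = 0 :=
  funext fun i =>
    (Finset.sum_eq_zero_iff_of_nonneg fun i _ => hx i).1 h i (Finset.mem_univ i)

/-- An extreme point of the base `∑ i, γ i = 1` of the cone `{γ ≥ 0 : B₂ᵀ γ ≤ 0}` spans an extreme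
half-line. -/
theorem isExtreme_halfLine_of_mem_extremePoints {γ : Fin ry → ℝ}
    (hγ : γ ∈ Set.extremePoints ℝ {γ ∈ dualPolyhedron B₂ 0 | ∑ i, γ i = 1}) :
    IsExtreme ℝ (dualPolyhedron B₂ 0) (halfLine γ) := by
  obtain ⟨⟨hγC, hγ₁⟩, hext⟩ := hγ
  refine ⟨?_, ?_⟩
  · rintro _ ⟨t, ht, rfl⟩
    exact smul_mem_dualPolyhedron_zero ht hγC
  · rintro x hx y hy _ ⟨t, ht, rfl⟩ ⟨a, b, ha, hb, -, h⟩
    have hsum : a * ∑ i, x i + b * ∑ i, y i = t := by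
      have := congrArg (fun v : Fin ry → ℝ => ∑ i, v i) h
      simpa [Finset.sum_add_distrib, ← Finset.mul_sum, hγ₁] using this
    have hx₀ : 0 ≤ ∑ i, x i := Finset.sum_nonneg fun i _ => hx.2 i
    have hy₀ : 0 ≤ ∑ i, y i := Finset.sum_nonneg fun i _ => hy.2 i
    rcases hx₀.eq_or_lt with hx₁ | hx₁
    · exact ⟨0, le_rfl, by rw [eq_zero_of_nonneg_of_sum_eq_zero hx.2 hx₁.symm, zero_smul]⟩
    have ht₁ : 0 < t := by
      rw [← hsum]
      exact add_pos_of_pos_of_nonneg (mul_pos ha hx₁) (mul_nonneg hb.le hy₀)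
    rcases hy₀.eq_or_lt with hy₁ | hy₁
    · rw [eq_zero_of_nonneg_of_sum_eq_zero hy.2 hy₁.symm, smul_zero, add_zero] at h
      refine ⟨t / a, by positivity, ?_⟩
      rw [div_eq_inv_mul, mul_smul, ← h, smul_smul, inv_mul_cancel₀ ha.ne', one_smul]
    · set sx := ∑ i, x i with hsx
      set sy := ∑ i, y i with hsy
      -- Rescale `x` and `y` to the base. The weights `a * sx / t` and `b * sy / t` sum to one since
      -- `t` is the coordinate sum of `t • γ`.
      have e : sx⁻¹ • x = γ := by
        refine hext (x₁ := sx⁻¹ • x) (x₂ := sy⁻¹ • y)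
          ⟨smul_mem_dualPolyhedron_zero (by positivity) hx, ?_⟩
          ⟨smul_mem_dualPolyhedron_zero (by positivity) hy, ?_⟩
          ⟨a * sx / t, b * sy / t, by positivity, by positivity, ?_, ?_⟩
        · simp [← Finset.mul_sum, ← hsx, hx₁.ne']
        · simp [← Finset.mul_sum, ← hsy, hy₁.ne']
        · rw [← add_div, hsum, div_self ht₁.ne']
        · have h₁ : a * sx / t * sx⁻¹ = t⁻¹ * a := by field_simp
          have h₂ : b * sy / t * sy⁻¹ = t⁻¹ * b := by field_simp
          rw [smul_smul, smul_smul, h₁, h₂, mul_smul, mul_smul, ← smul_add, h, smul_smul,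
            inv_mul_cancel₀ ht₁.ne', one_smul]
      exact ⟨sx, hx₁.le, by rw [← e, smul_smul, mul_inv_cancel₀ hx₁.ne', one_smul]⟩

/-- The base of the cone is compact, so `q` attains its maximum there at an extreme point; the
normalized `γ₀` shows that this maximum is positive. -/
theorem exists_extremeDirection_of_pos {q γ₀ : Fin ry → ℝ}
    (hne : (dualPolyhedron B₂ c₂).Nonempty) (hγ₀ : γ₀ ∈ dualPolyhedron B₂ 0)
    (hq : 0 < q ⬝ᵥ γ₀) : ∃ γ ∈ extremeDirections (dualPolyhedron B₂ c₂), 0 < q ⬝ᵥ γ := by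
  set D : Set (Fin ry → ℝ) := {γ ∈ dualPolyhedron B₂ 0 | ∑ i, γ i = 1} with hD
  have hDcompact : IsCompact D :=
    isCompact_of_nonneg_of_sum_le
      (isClosed_dualPolyhedron.inter (isClosed_eq (by fun_prop) continuous_const))
      fun γ hγ => ⟨hγ.1.2, hγ.2.le⟩
  have hs : 0 < ∑ i, γ₀ i := by
    refine (Finset.sum_nonneg fun i _ => hγ₀.2 i).lt_of_ne' fun h => ?_
    rw [eq_zero_of_nonneg_of_sum_eq_zero hγ₀.2 h, dotProduct_zero] at hq
    exact hq.false
  have hγ₁ : (∑ i, γ₀ i)⁻¹ • γ₀ ∈ D :=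
    ⟨smul_mem_dualPolyhedron_zero (by positivity) hγ₀, by simp [← Finset.mul_sum, hs.ne']⟩
  obtain ⟨γ₂, hγ₂, hmax⟩ := hDcompact.exists_isMaxOn ⟨_, hγ₁⟩ (f := fun γ => q ⬝ᵥ γ)
    (by fun_prop)
  have hpos : 0 < q ⬝ᵥ γ₂ := by
    refine lt_of_lt_of_le ?_ (hmax hγ₁)
    simp only [dotProduct_smul, smul_eq_mul]
    positivity
  have hface : IsCompact {γ ∈ D | dotFunctional q γ = q ⬝ᵥ γ₂} :=
    hDcompact.inter_right (isClosed_eq (f := fun γ => q ⬝ᵥ γ) (by fun_prop) continuous_const)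
  obtain ⟨γ, hγ⟩ := hface.extremePoints_nonempty ⟨γ₂, hγ₂, rfl⟩
  have hqγ : q ⬝ᵥ γ = q ⬝ᵥ γ₂ := (extremePoints_subset hγ).2
  refine ⟨γ, ⟨?_, ?_⟩, hqγ ▸ hpos⟩
  · rintro rfl
    rw [← hqγ, dotProduct_zero] at hpos
    exact hpos.false
  · rw [recessionCone_dualPolyhedron hne]
    exact isExtreme_halfLine_of_mem_extremePoints 
      (extremePoints_face_subset (f := dotFunctional q) (fun γ hγ => hmax hγ) hγ)

theorem extremeDirections_subset (hne : (dualPolyhedron B₂ c₂).Nonempty) :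
    extremeDirections (dualPolyhedron B₂ c₂) ⊆ dualPolyhedron B₂ 0 := by
  intro γ hγ
  rw [← recessionCone_dualPolyhedron hne]
  exact hγ.2.subset (self_mem_halfLine γ)

end

namespace Data

variable {mx nx nu ny rx ru ry : ℕ} {I : Data mx nx nu ny rx ru ry}
  {x : Fin mx ⊕ Fin nx → ℝ} {u : Fin nu → ℝ}

/-! ### The recourse problem -/

theorem rhs_dotProduct_le {c : Fin ny → ℝ} {π : Fin ry → ℝ} {y : Fin ny → ℝ}
    (hπ : π ∈ dualPolyhedron I.B₂ c) (hy : y ∈ I.Y x u) : I.rhs x u ⬝ᵥ π ≤ c ⬝ᵥ y :=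
  lp_weak_duality hπ.2 hπ.1 hy.1 hy.2

theorem rhs_dotProduct_nonpos {γ : Fin ry → ℝ} (hγ : γ ∈ dualPolyhedron I.B₂ 0)
    (hY : (I.Y x u).Nonempty) : I.rhs x u ⬝ᵥ γ ≤ 0 := by
  obtain ⟨y, hy⟩ := hY
  simpa using rhs_dotProduct_le hγ hy

theorem le_recourseValue {π : Fin ry → ℝ} (hπ : π ∈ dualPolyhedron I.B₂ I.c₂) :
    ((I.rhs x u ⬝ᵥ π : ℝ) : EReal) ≤ I.recourseValue x u :=
  le_iInf₂ fun _ hy => EReal.coe_le_coe_iff.2 (rhs_dotProduct_le hπ hy)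

theorem exists_pos_of_Y_empty (hY : ¬ (I.Y x u).Nonempty) :
    ∃ γ ∈ dualPolyhedron I.B₂ 0, 0 < I.rhs x u ⬝ᵥ γ := by
  by_contra! h
  obtain ⟨y, hy, hy'⟩ := farkas_matrix I.B₂ᵀ (I.rhs x u) fun γ hγ hBγ => h γ ⟨hBγ, hγ⟩
  exact hY ⟨y, hy, hy'⟩

theorem exists_recourseValue_eq (hne : (dualPolyhedron I.B₂ I.c₂).Nonempty)
    (hY : (I.Y x u).Nonempty) :
    ∃ π ∈ dualPoints I.B₂ I.c₂, I.recourseValue x u = ((I.rhs x u ⬝ᵥ π : ℝ) : EReal) := by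
  obtain ⟨π₀, hπ₀⟩ := hne
  obtain ⟨y₀, hy₀⟩ := hY
  obtain ⟨π, y, h₁, h₂, h₃, h₄, h₅⟩ := lp_strong_duality (A := I.B₂ᵀ) (b := I.c₂)
    (c := I.rhs x u) ⟨π₀, hπ₀.2, hπ₀.1⟩ ⟨y₀, hy₀⟩
  obtain ⟨π', hπ', e⟩ := exists_dualPoint_of_isMax (q := I.rhs x u) (π₀ := π) ⟨h₂, h₁⟩
    fun p hp => h₅ ▸ rhs_dotProduct_le hp ⟨h₃, h₄⟩
  refine ⟨π', hπ', le_antisymm ?_ (le_recourseValue hπ'.1)⟩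
  rw [e, h₅]
  exact iInf₂_le y ⟨h₃, h₄⟩

/-- Otherwise Farkas yields a recourse direction of negative cost, along which the relaxation in
(A3) would be unbounded below. -/
theorem dualPolyhedron_nonempty (hA3 : I.relaxationCosts.Nonempty ∧ BddBelow I.relaxationCosts) :
    (dualPolyhedron I.B₂ I.c₂).Nonempty := by
  obtain ⟨⟨v₀, x, hx, u, hu, y, hy, -⟩, ⟨w, hw⟩⟩ := hA3
  obtain ⟨π, hπ, hBπ⟩ := farkas_matrix (-I.B₂) (-I.c₂) (by
    intro v hv hBv
    rw [Matrix.neg_mulVec, neg_nonpos] at hBv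
    rw [neg_dotProduct]
    refine nonpos_of_forall_add_mul_le (p := -(I.c₂ ⬝ᵥ y)) (s := I.c₁ ⬝ᵥ x - w) fun t ht => ?_
    have hmem : y + t • v ∈ I.Y x u := by
      refine ⟨add_nonneg hy.1 (smul_nonneg ht hv), ?_⟩
      rw [Matrix.mulVec_add, Matrix.mulVec_smul]
      exact hy.2.trans (le_add_of_nonneg_right (smul_nonneg ht hBv))
    have := hw ⟨x, hx, u, hu, _, hmem, rfl⟩
    rw [dotProduct_add, dotProduct_smul, smul_eq_mul] at this
    linarith)
  refine ⟨π, ?_, hπ⟩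
  rw [Matrix.transpose_neg, Matrix.neg_mulVec] at hBπ
  exact neg_le_neg_iff.1 hBπ

/-! ### The uncertainty set and its KKT system -/

theorem isCompact_U (hb : Bornology.IsBounded (I.U x)) : IsCompact (I.U x) :=
  Metric.isCompact_of_isClosed_isBounded ((isClosed_le continuous_const continuous_id).inter
    (isClosed_le (f := fun u : Fin nu → ℝ => I.F x *ᵥ u) (by fun_prop) continuous_const)) hb

theorem eq_zero_of_recession (hU : (I.U x).Nonempty) (hb : Bornology.IsBounded (I.U x))
    {v : Fin nu → ℝ} (hv : 0 ≤ v) (hFv : I.F x *ᵥ v ≤ 0) : v = 0 := by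
  obtain ⟨u, hu⟩ := hU
  obtain ⟨w, hw⟩ := hb.bddAbove
  refine le_antisymm (fun i => nonpos_of_forall_add_mul_le (p := u i) (s := w i) fun t ht => ?_) hv
  have hmem : u + t • v ∈ I.U x := by
    refine ⟨add_nonneg hu.1 (smul_nonneg ht hv), ?_⟩
    rw [Matrix.mulVec_add, Matrix.mulVec_smul]
    simpa using add_le_add hu.2 (smul_nonpos_of_nonneg_of_nonpos ht hFv)
  exact hw hmem i

/-- A nonempty bounded 𝒰(x) has no nonzero recession direction, so Farkas makes the dual feasible
for every objective; an optimal pair with complementary slackness solves the KKT system. -/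
theorem KKT_nonempty (hU : (I.U x).Nonempty) (hb : Bornology.IsBounded (I.U x))
    (β : Fin ry → ℝ) : (I.KKT x β).Nonempty := by
  obtain ⟨u, l, h₁, h₂, h₃, h₄, h₅⟩ := lp_strong_duality (A := I.F x) (b := I.h + I.G *ᵥ x)
    (c := -(I.Eᵀ *ᵥ β)) hU (farkas_matrix _ _ fun v hv hFv => by
      rw [eq_zero_of_recession hU hb hv hFv, dotProduct_zero])
  obtain ⟨h₆, h₇⟩ := lp_complementary_slackness h₁ h₂ h₃ h₄ h₅
  rw [sub_neg_eq_add] at h₇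
  exact ⟨(u, l), h₂, h₄, h₆, h₇, h₁, h₃⟩

theorem mem_U_of_mem_KKT {β : Fin ry → ℝ} {p : (Fin nu → ℝ) × (Fin ru → ℝ)}
    (hp : p ∈ I.KKT x β) : p.1 ∈ I.U x :=
  ⟨hp.2.2.2.2.1, hp.1⟩

theorem dotProduct_eq_of_mul_sub_eq_zero {r : ℕ} {a b c : Fin r → ℝ} (h : a * (b - c) = 0) :
    a ⬝ᵥ b = a ⬝ᵥ c := by
  rw [← sub_eq_zero, ← dotProduct_sub]
  exact Finset.sum_eq_zero fun i _ => congrFun h i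

/-- A solution of the KKT system maximizes `(-E u)ᵀ β` over `𝒰(x)`. -/
theorem rhs_le_of_mem_KKT {β : Fin ry → ℝ} {p : (Fin nu → ℝ) × (Fin ru → ℝ)}
    (hp : p ∈ I.KKT x β) (hu : u ∈ I.U x) : I.rhs x u ⬝ᵥ β ≤ I.rhs x p.1 ⬝ᵥ β := by
  obtain ⟨h₁, h₂, h₃, h₄, h₅, h₆⟩ := hp
  have e₁ := dotProduct_eq_of_mul_sub_eq_zero h₃
  have e₂ := dotProduct_eq_of_mul_sub_eq_zero
    (b := (I.F x)ᵀ *ᵥ p.2) (c := -(I.Eᵀ *ᵥ β)) (by rw [sub_neg_eq_add]; exact h₄)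
  have e₃ := lp_weak_duality hu.1 hu.2 h₆ h₂
  have e₄ : p.1 ⬝ᵥ (I.F x)ᵀ *ᵥ p.2 = p.2 ⬝ᵥ I.F x *ᵥ p.1 := by
    rw [Matrix.mulVec_transpose, dotProduct_comm, ← Matrix.dotProduct_mulVec]
  have e₅ : ∀ v : Fin nu → ℝ, (I.Eᵀ *ᵥ β) ⬝ᵥ v = (I.E *ᵥ v) ⬝ᵥ β := fun v => by
    rw [Matrix.mulVec_transpose, ← Matrix.dotProduct_mulVec, dotProduct_comm]
  rw [dotProduct_comm (I.h + _), e₁, ← e₄, e₂, dotProduct_comm p.1, neg_dotProduct,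
    neg_dotProduct, e₅, e₅] at e₃
  simp only [rhs, sub_dotProduct]
  linarith

theorem cut_eq_rhs (β : Fin ry → ℝ) (u : Fin nu → ℝ) :
    β ⬝ᵥ I.d - β ⬝ᵥ (I.B₁ *ᵥ x) - β ⬝ᵥ (I.E *ᵥ u) = I.rhs x u ⬝ᵥ β := by
  simp only [rhs, sub_dotProduct, dotProduct_comm β]

/-! ### The subproblems -/

theorem continuous_rhs_dotProduct :
    Continuous fun p : (Fin nu → ℝ) × (Fin ry → ℝ) => I.rhs x p.1 ⬝ᵥ p.2 := by
  unfold rhs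
  fun_prop

/-- The worst case is the maximum of a continuous function over the compact product of 𝒰(x) with the
finite set of extreme points; a maximizing pair supplies `u` and `π` together. -/
theorem exists_isSP2Solution (hne : (dualPolyhedron I.B₂ I.c₂).Nonempty)
    (hU : (I.U x).Nonempty) (hb : Bornology.IsBounded (I.U x))
    (hY : ∀ u ∈ I.U x, (I.Y x u).Nonempty) : ∃ u π, I.IsSP2Solution x u π := by
  obtain ⟨u₀, hu₀⟩ := hU
  obtain ⟨π₀, hπ₀, -⟩ := exists_recourseValue_eq hne (hY u₀ hu₀)
  obtain ⟨⟨u, π⟩, ⟨hu, hπ⟩, hmax⟩ :=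
    ((isCompact_U hb).prod (dualPoints_finite I.B₂ I.c₂).1.isCompact).exists_isMaxOn
      ⟨(u₀, π₀), hu₀, hπ₀⟩ (continuous_rhs_dotProduct (I := I) (x := x)).continuousOn
  have hle : I.worstCase x ≤ ((I.rhs x u ⬝ᵥ π : ℝ) : EReal) := by
    refine iSup₂_le fun v hv => ?_
    obtain ⟨π', hπ', e⟩ := exists_recourseValue_eq hne (hY v hv)
    rw [e, EReal.coe_le_coe_iff]
    exact hmax (a := (v, π')) ⟨hv, hπ'⟩
  have h₁ : ((I.rhs x u ⬝ᵥ π : ℝ) : EReal) ≤ I.recourseValue x u := le_recourseValue hπ.1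
  have h₂ : I.recourseValue x u ≤ I.worstCase x :=
    le_iSup₂ (f := fun u _ => I.recourseValue x u) u hu
  exact ⟨u, π, hu, le_antisymm h₂ (hle.trans h₁), hπ, le_antisymm (h₁.trans h₂) hle⟩

/-- The feasible set of the dual of the first subproblem's inner problem. -/
def boxedCone (B₂ : Matrix (Fin ry) (Fin ny) ℝ) : Set (Fin ry → ℝ) :=
  dualPolyhedron B₂ 0 ∩ Set.Iic 1

theorem isCompact_boxedCone (B₂ : Matrix (Fin ry) (Fin ny) ℝ) : IsCompact (boxedCone B₂) :=
  (isCompact_Icc (a := (0 : Fin ry → ℝ)) (b := 1)).of_isClosed_subset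
    (isClosed_dualPolyhedron.inter isClosed_Iic) fun _ h => ⟨h.1.2, h.2⟩

/-- Linear programming duality: the unit cost of the slacks becomes the bound `π ≤ 1`, and the zero
cost of `y` turns Π into its recession cone. -/
theorem infeasibility_isMax (x : Fin mx ⊕ Fin nx → ℝ) (u : Fin nu → ℝ) :
    ∃ π ∈ boxedCone I.B₂, I.infeasibility x u = ((I.rhs x u ⬝ᵥ π : ℝ) : EReal) ∧
      ∀ π' ∈ boxedCone I.B₂, I.rhs x u ⬝ᵥ π' ≤ I.rhs x u ⬝ᵥ π := by
  set A : Matrix (Fin ny ⊕ Fin ry) (Fin ry) ℝ := Matrix.fromRows I.B₂ᵀ 1 with hA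
  have hprimal : ∀ π, A *ᵥ π ≤ (Sum.elim 0 1 : Fin ny ⊕ Fin ry → ℝ) ↔
      I.B₂ᵀ *ᵥ π ≤ 0 ∧ π ≤ 1 := fun π => by
    rw [hA, Matrix.fromRows_mulVec, Matrix.one_mulVec]
    simp [Pi.le_def]
  have hdual : ∀ z : Fin ny ⊕ Fin ry → ℝ,
      Aᵀ *ᵥ z = I.B₂ *ᵥ (z ∘ Sum.inl) + z ∘ Sum.inr := fun z => by
    rw [hA, Matrix.transpose_fromRows, Matrix.fromCols_mulVec]
    simp
  obtain ⟨π, z, h₁, h₂, h₃, h₄, h₅⟩ := lp_strong_duality (A := A) (b := Sum.elim 0 1)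
    (c := I.rhs x u) ⟨0, le_rfl, (hprimal 0).2 (by simp)⟩
    -- The choice `y = 0`, `ỹ = |rhs|` is always feasible.
    ⟨Sum.elim 0 |I.rhs x u|, fun i => by cases i <;> simp, by
      rw [hdual]
      simpa using le_abs_self (I.rhs x u)⟩
  have h₂' := (hprimal π).1 h₂
  have hval : ∀ z : Fin ny ⊕ Fin ry → ℝ,
      (Sum.elim 0 1 : Fin ny ⊕ Fin ry → ℝ) ⬝ᵥ z = ∑ i, z (Sum.inr i) := fun z => by
    simp [dotProduct, Fintype.sum_sum_type]
  refine ⟨π, ⟨⟨h₂'.1, h₁⟩, h₂'.2⟩, le_antisymm ?_ (le_iInf₂ fun p hp => ?_), fun π' hπ' => ?_⟩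
  · rw [h₅, hval]
    rw [hdual] at h₄
    exact iInf₂_le (f := fun (p : (Fin ny → ℝ) × (Fin ry → ℝ)) _ => ((∑ i, p.2 i : ℝ) : EReal))
      (z ∘ Sum.inl, z ∘ Sum.inr) ⟨fun _ => h₃ _, fun _ => h₃ _, h₄⟩
  · rw [EReal.coe_le_coe_iff]
    have := lp_weak_duality (c := I.rhs x u) (y := Sum.elim p.1 p.2) h₁ h₂
      (fun i => by cases i; exacts [hp.1 _, hp.2.1 _]) (by rw [hdual]; exact hp.2.2)
    rwa [hval] at this
  · rw [h₅]
    exact lp_weak_duality hπ'.1.2 ((hprimal π').2 ⟨hπ'.1.1, hπ'.2⟩) h₃ h₄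

theorem exists_isSP1Solution (hU : (I.U x).Nonempty) (hb : Bornology.IsBounded (I.U x)) :
    ∃ u, I.IsSP1Solution x u := by
  obtain ⟨u₀, hu₀⟩ := hU
  obtain ⟨π₀, hπ₀, -⟩ := infeasibility_isMax (I := I) x u₀
  obtain ⟨⟨u, π⟩, ⟨hu, hπ⟩, hmax⟩ :=
    ((isCompact_U hb).prod (isCompact_boxedCone I.B₂)).exists_isMaxOn ⟨(u₀, π₀), hu₀, hπ₀⟩
      (continuous_rhs_dotProduct (I := I) (x := x)).continuousOn
  refine ⟨u, hu, le_antisymm (le_iSup₂ (f := fun u _ => I.infeasibility x u) u hu)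
    (iSup₂_le fun v hv => ?_)⟩
  obtain ⟨πv, hπv, ev, -⟩ := infeasibility_isMax (I := I) x v
  obtain ⟨πu, hπu, eu, hu'⟩ := infeasibility_isMax (I := I) x u
  rw [ev, eu, EReal.coe_le_coe_iff]
  exact (hmax (a := (v, πv)) ⟨hv, hπv⟩).trans (hu' π hπ)

theorem etaF_nonneg (hU : (I.U x).Nonempty) : 0 ≤ I.etaF x := by
  obtain ⟨u, hu⟩ := hU
  refine le_trans (le_iInf₂ fun p hp => ?_) (le_iSup₂ (f := fun u _ => I.infeasibility x u) u hu)
  exact EReal.coe_nonneg.2 (Finset.sum_nonneg fun i _ => hp.2.1 i)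

theorem Y_nonempty_of_etaF_eq_zero (h : I.etaF x = 0) (hu : u ∈ I.U x) :
    (I.Y x u).Nonempty := by
  by_contra hY
  obtain ⟨γ, hγ, hpos⟩ := exists_pos_of_Y_empty hY
  obtain ⟨π, -, e, hmax⟩ := infeasibility_isMax (I := I) x u
  have hle : I.infeasibility x u ≤ 0 :=
    h ▸ le_iSup₂ (f := fun u _ => I.infeasibility x u) u hu
  rw [e, ← EReal.coe_zero, EReal.coe_le_coe_iff] at hle
  have hs : 0 ≤ ∑ i, γ i := Finset.sum_nonneg fun i _ => hγ.2 i
  -- Dividing by one plus the coordinate sum brings the Farkas certificate into the box and keeps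
  -- its value positive.
  have hmem : (1 + ∑ i, γ i)⁻¹ • γ ∈ boxedCone I.B₂ := by
    refine ⟨smul_mem_dualPolyhedron_zero (by positivity) hγ, fun i => ?_⟩
    have := Finset.single_le_sum (f := γ) (fun j _ => hγ.2 j) (Finset.mem_univ i)
    simp only [Pi.smul_apply, smul_eq_mul, Pi.one_apply]
    rw [inv_mul_le_iff₀ (by positivity)]
    linarith
  have := (hmax _ hmem).trans hle
  rw [dotProduct_smul, smul_eq_mul] at this
  have : 0 < (1 + ∑ i, γ i)⁻¹ * (I.rhs x u ⬝ᵥ γ) := by positivity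
  linarith

/-- The optimal dual vector in the boxed cone is itself a recession direction of Π with positive
value at this very `u`. -/
theorem exists_isSP3Ray (hne : (dualPolyhedron I.B₂ I.c₂).Nonempty) (h : 0 < I.etaF x)
    (hu : I.IsSP1Solution x u) : ∃ γ, I.IsSP3Ray x u γ := by
  obtain ⟨π, hπ, e, -⟩ := infeasibility_isMax (I := I) x u
  rw [← hu.2, e, EReal.coe_pos] at h
  exact exists_extremeDirection_of_pos hne hπ.1 h

end Data

namespace Data

variable {mx nx nu ny rx ru ry : ℕ} {I : Data mx nx nu ny rx ru ry}
  {x : Fin mx ⊕ Fin nx → ℝ}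

/-! ### The master problem is a relaxation -/

theorem worstCase_eq_top (h : ∃ u ∈ I.U x, ¬ (I.Y x u).Nonempty) : I.worstCase x = ⊤ := by
  obtain ⟨u, hu, hY⟩ := h
  refine top_le_iff.1 (le_trans ?_ (le_iSup₂ (f := fun u _ => I.recourseValue x u) u hu))
  simp [recourseValue, Set.not_nonempty_iff_eq_empty.1 hY]

/-- The standing assumptions, in the form in which they are used. -/
structure Regular (I : Data mx nx nu ny rx ru ry) : Prop where
  U_nonempty : ∀ x ∈ I.X, (I.U x).Nonempty
  U_bounded : ∀ x ∈ I.X, Bornology.IsBounded (I.U x)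
  dual_nonempty : (dualPolyhedron I.B₂ I.c₂).Nonempty

theorem Regular.exists_worstCase_eq (hI : I.Regular) (hx : I.IsFeasible x) :
    ∃ w : ℝ, I.worstCase x = w := by
  obtain ⟨u, π, h⟩ :=
    exists_isSP2Solution hI.dual_nonempty (hI.U_nonempty x hx.1) (hI.U_bounded x hx.1) hx.2
  exact ⟨_, h.2.2.2.symm⟩

/-- Any KKT solutions complete the point: their scenarios lie in 𝒰(x), where weak duality bounds
each cut. -/
theorem Regular.masterFeasible_of_isFeasible (hI : I.Regular) {P R : Set (Fin ry → ℝ)}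
    (hP : P ⊆ dualPoints I.B₂ I.c₂) (hR : R ⊆ extremeDirections (dualPolyhedron I.B₂ I.c₂))
    (hx : I.IsFeasible x) {w : ℝ} (hw : I.worstCase x = w) : I.MasterFeasible P R x w := by
  refine ⟨hx.1, fun π hπ => ?_, fun γ hγ => ?_⟩
  · obtain ⟨p, hp⟩ := KKT_nonempty (hI.U_nonempty x hx.1) (hI.U_bounded x hx.1) π
    refine ⟨p, hp, ?_⟩
    rw [cut_eq_rhs, ← EReal.coe_le_coe_iff, ← hw]
    exact (le_recourseValue (hP hπ).1).trans
      (le_iSup₂ (f := fun u _ => I.recourseValue x u) p.1 (mem_U_of_mem_KKT hp))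
  · obtain ⟨p, hp⟩ := KKT_nonempty (hI.U_nonempty x hx.1) (hI.U_bounded x hx.1) γ
    refine ⟨p, hp, ?_⟩
    rw [cut_eq_rhs]
    exact rhs_dotProduct_nonpos (extremeDirections_subset hI.dual_nonempty (hR hγ))
      (hx.2 _ (mem_U_of_mem_KKT hp))

theorem Regular.masterOutput_le_optValue (hI : I.Regular) {P R : Set (Fin ry → ℝ)}
    (hP : P ⊆ dualPoints I.B₂ I.c₂) (hR : R ⊆ extremeDirections (dualPolyhedron I.B₂ I.c₂))
    {LB : EReal} (h : I.MasterOutput P R x LB) : LB ≤ I.optValue := by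
  rcases h with ⟨η, hopt, rfl⟩ | ⟨-, -, rfl⟩
  · refine le_iInf₂ fun x' hx' => ?_
    by_cases hf : ∀ u ∈ I.U x', (I.Y x' u).Nonempty
    · obtain ⟨w, hw⟩ := hI.exists_worstCase_eq ⟨hx', hf⟩
      rw [hw, ← EReal.coe_add, EReal.coe_le_coe_iff]
      exact hopt.2 x' w (hI.masterFeasible_of_isFeasible hP hR ⟨hx', hf⟩ hw)
    · push Not at hf
      obtain ⟨u, hu, hY⟩ := hf
      rw [worstCase_eq_top ⟨u, hu, Set.not_nonempty_iff_eq_empty.2 hY⟩]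
      simp
  · exact bot_le

theorem MasterOutput.mem_X {P R : Set (Fin ry → ℝ)} {LB : EReal}
    (h : I.MasterOutput P R x LB) : x ∈ I.X := by
  rcases h with ⟨η, h, -⟩ | ⟨-, ⟨η, h⟩, -⟩
  exacts [h.1.1, h.1]

/-- In `EReal` the test `⊤ - ⊤ ≤ 0` succeeds; excluding `LB = ⊤` ensures that termination happens
with a finite upper bound. -/
theorem LB_ne_top_of_iteration {s s' : State mx nx ry} (h : I.Iteration s s') : s'.LB ≠ ⊤ := by
  obtain ⟨x, ηs, ⟨η, -, hLB⟩ | ⟨-, -, hLB⟩, -⟩ := h <;> rw [hLB]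
  exacts [EReal.coe_ne_top _, bot_ne_top]

/-! ### Invariants of the algorithm -/

/-- What holds between two iterations. -/
structure Invariant (I : Data mx nx nu ny rx ru ry) (s : State mx nx ry) : Prop where
  P_subset : s.P ⊆ dualPoints I.B₂ I.c₂
  R_subset : s.R ⊆ extremeDirections (dualPolyhedron I.B₂ I.c₂)
  optValue_le : I.optValue ≤ s.UB
  incumbent : s.UB = ⊤ ∨ ∃ x, s.incumbent = some x ∧ I.IsFeasible x ∧
    ((I.c₁ ⬝ᵥ x : ℝ) : EReal) + I.worstCase x = s.UB ∧ ∃ w : ℝ, s.UB = w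

theorem invariant_initialState : I.Invariant (initialState mx nx ry) :=
  ⟨Set.empty_subset _, Set.empty_subset _, le_top, Or.inl rfl⟩

theorem isFeasible_of_etaF_eq_zero (hx : x ∈ I.X) (h : I.etaF x = 0) : I.IsFeasible x :=
  ⟨hx, fun _ hu => Y_nonempty_of_etaF_eq_zero h hu⟩

theorem Regular.invariant_of_iteration (hI : I.Regular) {s s' : State mx nx ry}
    (hs : I.Invariant s) (h : I.Iteration s s') : I.Invariant s' := by
  obtain ⟨x, ηs, hout, ⟨uf, -, hsub⟩, hUB, hinc⟩ := h
  have hx := hout.mem_X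
  rcases hsub with ⟨h₀, us, π, hπ, hP', hR', rfl⟩ | ⟨-, γ, hγ, hP', hR', rfl⟩
  · have hf := isFeasible_of_etaF_eq_zero hx h₀
    obtain ⟨w, hw⟩ := hI.exists_worstCase_eq hf
    refine ⟨?_, hR' ▸ hs.R_subset, ?_, ?_⟩
    · rw [hP']
      exact Set.union_subset hs.P_subset (Set.singleton_subset_iff.2 hπ.2.2.1)
    · rw [hUB]
      exact le_min hs.optValue_le (iInf₂_le x hx)
    · rcases hinc with ⟨hle, hinc⟩ | ⟨hlt, hinc⟩
      · rw [min_eq_right hle] at hUB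
        exact Or.inr ⟨x, hinc, hf, hUB.symm, I.c₁ ⬝ᵥ x + w, by rw [hUB, hw, EReal.coe_add]⟩
      · rw [min_eq_left hlt.le] at hUB
        rw [hUB, hinc]
        exact hs.incumbent
  · rw [EReal.coe_add_top, min_eq_left le_top] at hUB
    refine ⟨hP' ▸ hs.P_subset, ?_, hUB ▸ hs.optValue_le, ?_⟩
    · rw [hR']
      exact Set.union_subset hs.R_subset (Set.singleton_subset_iff.2 hγ.1)
    -- An infeasible `x` becomes the incumbent only by a tie at `⊤`; the invariant then claims
    -- nothing about it.
    · rcases hinc with ⟨hle, -⟩ | ⟨-, hinc⟩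
      · rw [EReal.coe_add_top, top_le_iff] at hle
        exact Or.inl (hUB.trans hle)
      · rw [hUB, hinc]
        exact hs.incumbent

theorem Regular.LB_le_optValue (hI : I.Regular) {s s' : State mx nx ry}
    (hs : I.Invariant s) (h : I.Iteration s s') : s'.LB ≤ I.optValue := by
  obtain ⟨x, ηs, hout, -⟩ := h
  exact hI.masterOutput_le_optValue hs.P_subset hs.R_subset hout

/-- The number of extreme points and extreme rays collected so far. -/
noncomputable def cutCount (s : State mx nx ry) : ℕ := s.P.ncard + (halfLine '' s.R).ncard

theorem Regular.cutCount_le (hI : I.Regular) {s : State mx nx ry} (hs : I.Invariant s) :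
    cutCount s ≤ (dualPoints I.B₂ I.c₂).ncard + (dualRays I.B₂ I.c₂).ncard :=
  Nat.add_le_add (Set.ncard_le_ncard hs.P_subset (dualPoints_finite I.B₂ I.c₂).1)
    (Set.ncard_le_ncard (Set.image_mono hs.R_subset) (dualRays_finite hI.dual_nonempty).1)

/-- A repeated extreme point closes the gap between the bounds. -/
theorem sub_nonpos_of_mem {P R : Set (Fin ry → ℝ)} {LB UB : EReal} {us : Fin nu → ℝ}
    {π : Fin ry → ℝ} (hout : I.MasterOutput P R x LB) (hπ : I.IsSP2Solution x us π)
    (hUB : UB ≤ ((I.c₁ ⬝ᵥ x : ℝ) : EReal) + I.worstCase x) (hmem : π ∈ P) : UB - LB ≤ 0 := by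
  rcases hout with ⟨η, hopt, rfl⟩ | ⟨rfl, -⟩
  -- The old cut for `π` is evaluated at a scenario maximizing it over the present 𝒰(x), so it
  -- dominates the value at `us`, which is the worst-case cost. Hence `UB ≤ c₁x + η = LB`.
  · obtain ⟨p, hp, hcut⟩ := hopt.1.2.1 π hmem
    rw [cut_eq_rhs] at hcut
    rw [← hπ.2.2.2, ← EReal.coe_add] at hUB
    refine (EReal.sub_le_sub hUB le_rfl).trans ?_
    rw [← EReal.coe_sub, ← EReal.coe_zero, EReal.coe_le_coe_iff]
    linarith [rhs_le_of_mem_KKT hp hπ.1]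
  · exact absurd hmem (Set.notMem_empty π)

/-- An extreme ray is never found twice. -/
theorem halfLine_notMem {P R : Set (Fin ry → ℝ)} {LB : EReal} {uf : Fin nu → ℝ}
    {γ : Fin ry → ℝ} (hout : I.MasterOutput P R x LB) (hu : uf ∈ I.U x) (hγ : I.IsSP3Ray x uf γ) :
    halfLine γ ∉ halfLine '' R := by
  rintro ⟨δ, hδ, heq⟩
  obtain ⟨η, hfeas⟩ : ∃ η, I.MasterFeasible P R x η := by
    rcases hout with ⟨η, h, -⟩ | ⟨-, h, -⟩
    exacts [⟨η, h.1⟩, h]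
  obtain ⟨p, hp, hcut⟩ := hfeas.2.2 δ hδ
  rw [cut_eq_rhs] at hcut
  have hle := (rhs_le_of_mem_KKT hp hu).trans hcut
  obtain ⟨t, ht, rfl⟩ : γ ∈ halfLine δ := heq ▸ self_mem_halfLine γ
  have hpos := hγ.2
  rw [dotProduct_smul, smul_eq_mul] at hpos
  exact absurd hpos (not_lt.2 (mul_nonpos_of_nonneg_of_nonpos ht hle))

/-- A repeated point would pass the termination test and a repeated ray is impossible, so exactly
one new element is counted. Rays are counted as half-lines, since generators may differ by a factor.
-/
theorem Regular.cutCount_succ_le (hI : I.Regular) {s s' : State mx nx ry}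
    (hs : I.Invariant s) (h : I.Continues 0 s s') : cutCount s + 1 ≤ cutCount s' := by
  have hs' := hI.invariant_of_iteration hs h.1
  obtain ⟨⟨x, ηs, hout, ⟨uf, huf, hsub⟩, hUB, -⟩, hgap⟩ := h
  have hPfin : s.P.Finite := (dualPoints_finite I.B₂ I.c₂).1.subset hs.P_subset
  have hRfin : (halfLine '' s.R).Finite :=
    (dualRays_finite hI.dual_nonempty).1.subset (Set.image_mono hs.R_subset)
  rcases hsub with ⟨-, us, π, hπ, hP', hR', rfl⟩ | ⟨-, γ, hγ, hP', hR', -⟩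
  · have hmem : π ∉ s.P := fun hmem =>
      hgap (sub_nonpos_of_mem hout hπ (hUB.trans_le (min_le_right _ _)) hmem)
    rw [cutCount, cutCount, hP', hR', Set.union_singleton, Set.ncard_insert_of_notMem hmem hPfin]
    omega
  · have hmem := halfLine_notMem hout huf.1 hγ
    rw [cutCount, cutCount, hP', hR', Set.union_singleton, Set.image_insert_eq,
      Set.ncard_insert_of_notMem hmem hRfin]
    omega

theorem Regular.invariant_of_reaches (hI : I.Regular) {s₀ s : State mx nx ry} {t : ℕ}
    (h : I.Reaches 0 s₀ t s) (hs₀ : I.Invariant s₀) :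
    I.Invariant s ∧ cutCount s₀ + t ≤ cutCount s := by
  induction h with
  | start => exact ⟨hs₀, le_rfl⟩
  | next _ hc ih =>
    exact ⟨hI.invariant_of_iteration ih.1 hc.1, by
      have := hI.cutCount_succ_le ih.1 hc
      omega⟩

/-! ### Correctness -/

theorem Regular.not_isFeasible_of_reportsInfeasible (hI : I.Regular) {s : State mx nx ry}
    (hs : I.Invariant s) (h : I.ReportsInfeasible s) : ¬ ∃ x, I.IsFeasible x := by
  rintro ⟨x, hx⟩
  obtain ⟨w, hw⟩ := hI.exists_worstCase_eq hx
  exact h ⟨x, w, hI.masterFeasible_of_isFeasible hs.P_subset hs.R_subset hx hw⟩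

theorem Invariant.exists_incumbent {s : State mx nx ry} (hs : I.Invariant s)
    (hLB : s.LB ≠ ⊤) (hgap : s.UB - s.LB ≤ 0) : ∃ x, s.incumbent = some x ∧ I.IsFeasible x ∧
      ((I.c₁ ⬝ᵥ x : ℝ) : EReal) + I.worstCase x = s.UB ∧
      (∃ w : ℝ, s.UB = w) ∧ s.UB ≤ s.LB := by
  rw [EReal.sub_nonpos] at hgap
  rcases hs.incumbent with htop | ⟨x, h₁, h₂, h₃, h₄⟩
  · exact absurd (top_le_iff.1 (htop ▸ hgap)) hLB
  · exact ⟨x, h₁, h₂, h₃, h₄, hgap⟩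

theorem Regular.isOptimal_of_returns (hI : I.Regular) {s s' : State mx nx ry}
    (hs : I.Invariant s) (h : I.Returns 0 s s' x) :
    I.IsOptimal x ∧ s'.LB = I.optValue ∧ s'.UB = I.optValue ∧ ∃ w : ℝ, I.optValue = w := by
  obtain ⟨hit, hgap, hinc⟩ := h
  have hs' := hI.invariant_of_iteration hs hit
  have hLB := hI.LB_le_optValue hs hit
  obtain ⟨x', h₁, h₂, h₃, ⟨w, hw⟩, hle⟩ := hs'.exists_incumbent (LB_ne_top_of_iteration hit) hgap
  obtain rfl : x = x' := by simpa [hinc] using h₁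
  have hUB : s'.UB = I.optValue := le_antisymm (hle.trans hLB) hs'.optValue_le
  exact ⟨⟨h₂, h₃.trans hUB⟩, le_antisymm hLB (hs'.optValue_le.trans hle), hUB, w,
    hUB.symm.trans hw⟩

/-! ### Existence of iterations and termination -/

theorem Regular.exists_iteration (hI : I.Regular) {s : State mx nx ry}
    (hsolv : I.MasterSolvable s) (h : ∃ x η, I.MasterFeasible s.P s.R x η) :
    ∃ s', I.Iteration s s' := by
  obtain ⟨x, LB, hout⟩ : ∃ x LB, I.MasterOutput s.P s.R x LB := by
    rcases s.P.eq_empty_or_nonempty with hP | hP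
    · obtain ⟨x, η, hη⟩ := h
      exact ⟨x, ⊥, Or.inr ⟨hP, ⟨η, hη⟩, rfl⟩⟩
    · obtain ⟨x, η, hη⟩ := hsolv hP h
      exact ⟨x, _, Or.inl ⟨η, hη, rfl⟩⟩
  have hx := hout.mem_X
  obtain ⟨P', R', ηs, hsub⟩ : ∃ P' R' ηs, I.SubproblemStep s x P' R' ηs := by
    obtain ⟨uf, huf⟩ := exists_isSP1Solution (hI.U_nonempty x hx) (hI.U_bounded x hx)
    rcases (etaF_nonneg (hI.U_nonempty x hx)).eq_or_lt with h₀ | hpos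
    · obtain ⟨us, π, hπ⟩ := exists_isSP2Solution hI.dual_nonempty (hI.U_nonempty x hx)
        (hI.U_bounded x hx) (isFeasible_of_etaF_eq_zero hx h₀.symm).2
      exact ⟨_, _, _, uf, huf, Or.inl ⟨h₀.symm, us, π, hπ, rfl, rfl, rfl⟩⟩
    · obtain ⟨γ, hγ⟩ := exists_isSP3Ray hI.dual_nonempty hpos huf
      exact ⟨_, _, _, uf, huf, Or.inr ⟨hpos, γ, hγ, rfl, rfl, rfl⟩⟩
  rcases le_or_gt (((I.c₁ ⬝ᵥ x : ℝ) : EReal) + ηs) s.UB with hle | hlt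
  · exact ⟨⟨LB, _, P', R', some x⟩, x, ηs, hout, hsub, rfl, Or.inl ⟨hle, rfl⟩⟩
  · exact ⟨⟨LB, _, P', R', s.incumbent⟩, x, ηs, hout, hsub, rfl, Or.inr ⟨hlt, rfl⟩⟩

theorem Regular.progress (hI : I.Regular) {s : State mx nx ry} (hs : I.Invariant s)
    (hsolv : I.MasterSolvable s) :
    I.ReportsInfeasible s ∨ (∃ s' x, I.Returns 0 s s' x) ∨ ∃ s', I.Continues 0 s s' := by
  by_cases h : ∃ x η, I.MasterFeasible s.P s.R x η
  · obtain ⟨s', hit⟩ := hI.exists_iteration hsolv h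
    by_cases hgap : s'.UB - s'.LB ≤ 0
    · obtain ⟨x, hinc, -⟩ :=
        (hI.invariant_of_iteration hs hit).exists_incumbent (LB_ne_top_of_iteration hit) hgap
      exact Or.inr (Or.inl ⟨s', x, hit, hgap, hinc⟩)
    · exact Or.inr (Or.inr ⟨s', hit, hgap⟩)
  · exact Or.inl h

theorem Reaches.trans {TOL : ℝ} {s₀ s s' : State mx nx ry} {t t' : ℕ}
    (h : I.Reaches TOL s₀ t s) (h' : I.Reaches TOL s t' s') : I.Reaches TOL s₀ (t + t') s' := by
  induction h' with
  | start => exact h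
  | next _ hc ih => exact ih.next hc

theorem Regular.le_of_runs (hI : I.Regular) {s : State mx nx ry} {t : ℕ} (h : I.Runs 0 t s) :
    I.Invariant s ∧ t ≤ (dualPoints I.B₂ I.c₂).ncard + (dualRays I.B₂ I.c₂).ncard := by
  obtain ⟨hs, hcount⟩ := hI.invariant_of_reaches h invariant_initialState
  have := hI.cutCount_le hs
  exact ⟨hs, by omega⟩

/-- Induction on the number of points and rays still available after `t` iterations. -/
theorem Regular.terminates (hI : I.Regular) (hsolv : ∀ t s, I.Runs 0 t s → I.MasterSolvable s)
    {s : State mx nx ry} {t : ℕ} (h : I.Runs 0 t s) :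
    ∃ t' s', I.Reaches 0 s t' s' ∧
      t + t' ≤ (dualPoints I.B₂ I.c₂).ncard + (dualRays I.B₂ I.c₂).ncard ∧
      ((I.ReportsInfeasible s' ∧ ¬ ∃ x, I.IsFeasible x) ∨
        ∃ s'' x, I.Returns 0 s' s'' x ∧ I.IsOptimal x) := by
  obtain ⟨hs, hle⟩ := hI.le_of_runs h
  induction hk : (dualPoints I.B₂ I.c₂).ncard + (dualRays I.B₂ I.c₂).ncard - t
    generalizing t s with
  | zero =>
    rcases hI.progress hs (hsolv t s h) with hrep | ⟨s', x, hret⟩ | ⟨s', hcont⟩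
    · exact ⟨0, s, .start, hle, Or.inl ⟨hrep, hI.not_isFeasible_of_reportsInfeasible hs hrep⟩⟩
    · exact ⟨0, s, .start, hle, Or.inr ⟨s', x, hret, (hI.isOptimal_of_returns hs hret).1⟩⟩
    -- With nothing left to collect, one more iteration without termination would exceed the bound.
    · have := (hI.le_of_runs (Reaches.next h hcont)).2
      omega
  | succ k ih =>
    rcases hI.progress hs (hsolv t s h) with hrep | ⟨s', x, hret⟩ | ⟨s', hcont⟩
    · exact ⟨0, s, .start, hle, Or.inl ⟨hrep, hI.not_isFeasible_of_reportsInfeasible hs hrep⟩⟩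
    · exact ⟨0, s, .start, hle, Or.inr ⟨s', x, hret, (hI.isOptimal_of_returns hs hret).1⟩⟩
    · have hrun : I.Runs 0 (t + 1) s' := Reaches.next h hcont
      obtain ⟨hs', hle'⟩ := hI.le_of_runs hrun
      obtain ⟨t', s'', hreach, hle'', hend⟩ := ih hrun hs' hle' (by omega)
      refine ⟨1 + t', s'', Reaches.trans (Reaches.next .start hcont) hreach, by omega, hend⟩

end Data

end TwoStageDDU

theorem mainTheorem2 {mx nx nu ny rx ru ry : ℕ}
    (I : TwoStageDDU.Data mx nx nu ny rx ru ry)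
    (hA1 : ∀ x ∈ I.X, (I.U x).Nonempty)
    (hA2 : ∀ x ∈ I.X, Bornology.IsBounded (I.U x))
    (hA3 : I.relaxationCosts.Nonempty ∧ BddBelow I.relaxationCosts) :
    -- the recourse dual polyhedron has finitely many extreme points and extreme rays
    (TwoStageDDU.dualPoints I.B₂ I.c₂).Finite ∧
    (TwoStageDDU.dualRays I.B₂ I.c₂).Finite ∧
    -- explicit bounds for their number
    (TwoStageDDU.dualPoints I.B₂ I.c₂).ncard ≤ (ny + ry).choose ry ∧
    (TwoStageDDU.dualPoints I.B₂ I.c₂).ncard + (TwoStageDDU.dualRays I.B₂ I.c₂).ncard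
      ≤ (ny + ry + 1).choose ry ∧
    (ry ≤ ny + 1 →
      (TwoStageDDU.dualPoints I.B₂ I.c₂).ncard + (TwoStageDDU.dualRays I.B₂ I.c₂).ncard
        ≤ 2 * (ny + ry).choose ry) ∧
    -- every run with tolerance zero
    (∀ t s, I.Runs 0 t s →
      -- the number of iterations before termination
      t ≤ (TwoStageDDU.dualPoints I.B₂ I.c₂).ncard + (TwoStageDDU.dualRays I.B₂ I.c₂).ncard ∧
      -- a report of infeasibility is correct
      (I.ReportsInfeasible s → ¬ ∃ x, I.IsFeasible x) ∧
      -- a returned solution is optimal, and both bounds equal the (finite) optimal value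
      (∀ s' x, I.Returns 0 s s' x →
        I.IsOptimal x ∧ s'.LB = I.optValue ∧ s'.UB = I.optValue ∧
          ∃ w : ℝ, I.optValue = (w : EReal)) ∧
      -- the run gets stuck at no state whose master problem can be solved
      (I.MasterSolvable s →
        I.ReportsInfeasible s ∨ (∃ s' x, I.Returns 0 s s' x) ∨ ∃ s', I.Continues 0 s s')) ∧
    -- if the master problems that can be met are solvable, every partial run can be continued to
    -- termination with the right answer (and by the bound above no run is infinite)
    ((∀ t s, I.Runs 0 t s → I.MasterSolvable s) →
      ∀ t s, I.Runs 0 t s → ∃ t' s', I.Reaches 0 s t' s' ∧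
        t + t' ≤ (TwoStageDDU.dualPoints I.B₂ I.c₂).ncard
          + (TwoStageDDU.dualRays I.B₂ I.c₂).ncard ∧
        ((I.ReportsInfeasible s' ∧ ¬ ∃ x, I.IsFeasible x) ∨
          ∃ s'' x, I.Returns 0 s' s'' x ∧ I.IsOptimal x)) := by
  have hI : I.Regular := ⟨hA1, hA2, TwoStageDDU.Data.dualPolyhedron_nonempty hA3⟩
  obtain ⟨hPfin, hPcard⟩ := TwoStageDDU.dualPoints_finite I.B₂ I.c₂
  obtain ⟨hRfin, hRcard, hRcard'⟩ := TwoStageDDU.dualRays_finite hI.dual_nonempty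
  refine ⟨hPfin, hRfin, hPcard, by omega, fun hr => ?_, fun t s h => ?_,
    fun hsolv t s h => hI.terminates hsolv h⟩
  · have := hRcard' hr
    omega
  · obtain ⟨hs, hle⟩ := hI.le_of_runs h
    exact ⟨hle, hI.not_isFeasible_of_reportsInfeasible hs,
      fun s' x hret => hI.isOptimal_of_returns hs hret, hI.progress hs⟩
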